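/- Let $r\ge 1$, let $\boldsymbol m=(m_1,\dots,m_r)$, $\boldsymbol l=(l_1,\dots,l_r)$ be sequences of non-negative integers and $k\ge 0$ an integer; put $l_0=k$, $l_{r+1}=0$. Call $(\boldsymbol m,\boldsymbol l,k)$ consistent if $k\ge l_1\ge\dots\ge l_r\ge 0$ and $l_s-l_{s+1}\le m_s$ for $s=1,\dots,r$. For consistent parameters let $V(\boldsymbol l,k)$ (resp. $U(\boldsymbol l,k)$) be the unique $(r+1)$-dimensional space of complex polynomials in $x$ without base points (no common zero in $\mathbb C$), whose Wronskian has no roots outside $\{0,1\}$, and such that - the orders of vanishing at $0$ of its non-zero elements are the numbers $i+\sum_{s=1}^{i}m_s$ (resp. $i+\sum_{s=1}^{i}m_{r+1-s}$), $0\le i\le r$; - the orders of vanishing at $1$ of its non-zero elements are $0,k+1,k+2,\dots,k+r$ (resp. $0,1,\dots,r-1,k+r$); - the degrees of its non-zero elements are $e_i=k+\sum_{s=1}^{i}m_s-l_i+l_{i+1}+i$ (resp. $e_i^\vee=\sum_{s=r+1-i}^{r}m_s-l_{r-i+1}+l_{r-i}+i$), $0\le i\le r$. Let $T_1=(x-1)^kx^{m_1}$,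 $T_j=x^{m_j}$ for $2\le j\le r$, and for $1\le n\le r+1$ and $f_1,\dots,f_n\in V(\boldsymbol l,k)$ let $$W^\dagger_{V(\boldsymbol l,k)}(f_1,\dots,f_n)=W(f_1,\dots,f_n)\,T_1^{1-n}T_2^{2-n}\cdots T_{n-1}^{-1}$$ be the divided Wronskian, $W$ being the Wronskian. Then $U(\boldsymbol l,k)=\{W^\dagger_{V(\boldsymbol l,k)}(f_1,\dots,f_r): f_j\in V(\boldsymbol l,k)\}$, and the rule $$\langle f,g\rangle_{\boldsymbol l,k}=W^\dagger_{V(\boldsymbol l,k)}(f,f_1,\dots,f_r)\quad\text{if } g=W^\dagger_{V(\boldsymbol l,k)}(f_1,\dots,f_r)$$ gives a well-defined non-degenerate bilinear pairing $V(\boldsymbol l,k)\times U(\boldsymbol l,k)\to\mathbb C$. For $0\le i\le r$ let $\boldsymbol 1_i$ be the sequence of $i$ ones followed by $r-i$ zeros, and let $$D_i(\boldsymbol l,k)=x(x-1)\frac{d}{dx}-\Big(k+\sum_{s=1}^{i}m_s-l_i+l_{i+1}+i\Big)(x-1)-k-1,$$ $$D_i^\vee(\boldsymbol l,k)=x\frac{d}{dx}-\Big(\sum_{s=i+1}^{r}m_s-l_{i+1}+l_i+r-i\Big).$$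 **Proposition.** Let $0\le i\le r$ and let $(\boldsymbol m,\boldsymbol l,k)$ and $(\boldsymbol m,\boldsymbol l+\boldsymbol 1_i,k+1)$ be consistent. Then $D_i(\boldsymbol l,k)$ maps $V(\boldsymbol l,k)$ to $V(\boldsymbol l+\boldsymbol 1_i,k+1)$, $D_i^\vee(\boldsymbol l+\boldsymbol 1_i,k+1)$ maps $U(\boldsymbol l+\boldsymbol 1_i,k+1)$ to $U(\boldsymbol l,k)$, and the operators $D_i(\boldsymbol l,k)$ and $-D_i^\vee(\boldsymbol l+\boldsymbol 1_i,k+1)$ are adjoint: for all $f\in V(\boldsymbol l,k)$ and $g\in U(\boldsymbol l+\boldsymbol 1_i,k+1)$, $$\langle D_i(\boldsymbol l,k)f,\,g\rangle_{\boldsymbol l+\boldsymbol 1_i,k+1}=-\langle f,\,D_i^\vee(\boldsymbol l+\boldsymbol 1_i,k+1)g\rangle_{\boldsymbol l,k}.$$ -/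

import Mathlib

open Polynomial

namespace TwoPointSpaces

/-! The parameters are a number `r`, sequences `m = (m_1, …, m_r)` and `l = (l_1, …, l_r)` of
natural numbers, and a natural number `k`. Entries of sequences are stored with indices starting
from `0`, so `m_s` is `m ⟨s - 1, _⟩`. -/

/-- The number `l_j` for every index `j`, with the conventions `l_0 = k` and `l_j = 0` for
`j > r`. -/
def lExt {r : ℕ} (l : Fin r → ℕ) (k : ℕ) : ℕ → ℕ
  | 0 => k
  | j + 1 => if h : j < r then l ⟨j, h⟩ else 0

/-- Consistency: `k ≥ l_1 ≥ ⋯ ≥ l_r ≥ 0` and `l_s - l_{s+1} ≤ m_s` for `s = 1, …, r`. -/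
def Consistent {r : ℕ} (m l : Fin r → ℕ) (k : ℕ) : Prop :=
  (∀ j < r, lExt l k (j + 1) ≤ lExt l k j) ∧
    ∀ s : Fin r, lExt l k (s + 1) ≤ lExt l k (s + 2) + m s

/-- `l + 1_i`, where `1_i` is the sequence of `i` ones followed by zeros. -/
def addOnes {r : ℕ} (l : Fin r → ℕ) (i : ℕ) : Fin r → ℕ :=
  fun j => if (j : ℕ) < i then l j + 1 else l j

/-- `e_i = k + ∑_{s=1}^{i} m_s - l_i + l_{i+1} + i`. -/
def eExp {r : ℕ} (m l : Fin r → ℕ) (k i : ℕ) : ℤ :=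
  k + (∑ s : Fin r, if (s : ℕ) < i then (m s : ℤ) else 0) - lExt l k i + lExt l k (i + 1) + i

/-- `e_i^∨ = ∑_{s=r+1-i}^{r} m_s - l_{r-i+1} + l_{r-i} + i` (for `i ≤ r`). -/
def eExpDual {r : ℕ} (m l : Fin r → ℕ) (k i : ℕ) : ℤ :=
  (∑ s : Fin r, if r - i ≤ (s : ℕ) then (m s : ℤ) else 0) - lExt l k (r - i + 1) + lExt l k (r - i) + i

/-- The number `i + n_1 + ⋯ + n_i`, the `i`-th exponent at a point attached to `(n_1, …, n_r)`. -/
def exponent {r : ℕ} (n : Fin r → ℕ) (i : ℕ) : ℕ :=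
  i + ∑ s : Fin r, if (s : ℕ) < i then n s else 0

/-- The Wronskian `det (d^i f_j / dx^i)` of finitely many polynomials. -/
noncomputable def wronskianDet {n : ℕ} (f : Fin n → ℂ[X]) : ℂ[X] :=
  (Matrix.of fun i j : Fin n => derivative^[(i : ℕ)] (f j)).det

/-- The orders of vanishing at `z` of the nonzero elements of `V`. -/
def exponentsAt (V : Submodule ℂ ℂ[X]) (z : ℂ) : Set ℕ :=
  {a | ∃ f ∈ V, f ≠ 0 ∧ f.rootMultiplicity z = a}

/-- The degrees of the nonzero elements of `V`. -/
def exponentsAtInfinity (V : Submodule ℂ ℂ[X]) : Set ℕ :=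
  {a | ∃ f ∈ V, f ≠ 0 ∧ f.natDegree = a}

/-- `z` is a root of the Wronskian of a basis (equivalently, of every basis) of the
`(r+1)`-dimensional space `V`. -/
def IsSingularPoint (r : ℕ) (V : Submodule ℂ ℂ[X]) (z : ℂ) : Prop :=
  ∃ b : Module.Basis (Fin (r + 1)) ℂ V, (wronskianDet fun j => (b j : ℂ[X])).IsRoot z

/-- An `(r+1)`-dimensional space of polynomials without base points and without singular points
outside `{0, 1}`, whose exponents at `0`, at `1` and at infinity are given by `n0`, `n1` and by
the numbers `e 0, …, e r`. -/
structure HasExponents {r : ℕ} (n0 n1 : Fin r → ℕ) (e : ℕ → ℤ) (V : Submodule ℂ ℂ[X]) :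
    Prop where
  finrank_eq : Module.finrank ℂ V = r + 1
  no_base_point : ∀ z : ℂ, ∃ f ∈ V, f.eval z ≠ 0
  singular : ∀ z : ℂ, IsSingularPoint r V z → z = 0 ∨ z = 1
  at_zero : exponentsAt V 0 = {a | ∃ i ≤ r, a = exponent n0 i}
  at_one : exponentsAt V 1 = {a | ∃ i ≤ r, a = exponent n1 i}
  at_infinity : exponentsAtInfinity V = {a : ℕ | ∃ i ≤ r, (a : ℤ) = e i}

/-- `V` is the space `V(m, l, k)`: `n(0) = m`, `n(1) = (k, 0, …, 0)`, degrees `e_0, …, e_r`. -/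
def IsSpaceV {r : ℕ} (m l : Fin r → ℕ) (k : ℕ) (V : Submodule ℂ ℂ[X]) : Prop :=
  HasExponents m (fun s => if (s : ℕ) = 0 then k else 0) (eExp m l k) V

/-- `U` is the space `U(m, l, k)`: `n(0) = (m_r, …, m_1)`, `n(1) = (0, …, 0, k)`, degrees
`e_0^∨, …, e_r^∨`. -/
def IsSpaceU {r : ℕ} (m l : Fin r → ℕ) (k : ℕ) (U : Submodule ℂ ℂ[X]) : Prop :=
  HasExponents (fun s => m s.rev) (fun s => if (s : ℕ) + 1 = r then k else 0) (eExpDual m l k) U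

/-- `T_1 = (x - 1)^k x^{m_1}` and `T_i = x^{m_i}` for `i ≥ 2`. -/
noncomputable def tPoly {r : ℕ} (m : Fin r → ℕ) (k : ℕ) (j : Fin r) : ℂ[X] :=
  if (j : ℕ) = 0 then (X - 1) ^ k * X ^ m j else X ^ m j

/-- The divided Wronskian `W(f_1, …, f_n) T_1^{1-n} T_2^{2-n} ⋯ T_{n-1}^{-1}`, as a rational
function. The index `j` stands for `T_{j+1}`, and the truncated exponent `n - (j + 1)` vanishes
exactly for the factors that do not occur. -/
noncomputable def dividedWronskian {r : ℕ} (m : Fin r → ℕ) (k : ℕ) {n : ℕ} (f : Fin n → ℂ[X]) :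
    RatFunc ℂ :=
  algebraMap ℂ[X] (RatFunc ℂ) (wronskianDet f) /
    ∏ j : Fin r, algebraMap ℂ[X] (RatFunc ℂ) (tPoly m k j) ^ (n - ((j : ℕ) + 1))

/-- `B` is the pairing `V ⊗ U → ℂ` given by `⟨f, g⟩ = W†(f, f_1, …, f_r)` whenever
`g = W†(f_1, …, f_r)` with `f_1, …, f_r ∈ V`. The first field says that `U` is exactly the set of
all `W†(f_1, …, f_r)`, so `B` is determined by the second one. -/
structure IsDividedWronskianPairing {r : ℕ} (m : Fin r → ℕ) (k : ℕ) {V U : Submodule ℂ ℂ[X]}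
    (B : V →ₗ[ℂ] U →ₗ[ℂ] ℂ) : Prop where
  dual : {w : RatFunc ℂ | ∃ g ∈ U, w = algebraMap ℂ[X] (RatFunc ℂ) g} =
    {w | ∃ F : Fin r → V, w = dividedWronskian m k fun j => (F j : ℂ[X])}
  value : ∀ (f : V) (F : Fin r → V) (g : U),
    algebraMap ℂ[X] (RatFunc ℂ) g = dividedWronskian m k (fun j => (F j : ℂ[X])) →
      dividedWronskian m k (Fin.cons (f : ℂ[X]) fun j => (F j : ℂ[X])) = RatFunc.C (B f g)

/-- `D_i(l, k) = x (x - 1) d/dx - e_i (x - 1) - (k + 1)`. -/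
noncomputable def opD {r : ℕ} (m l : Fin r → ℕ) (k i : ℕ) : ℂ[X] →ₗ[ℂ] ℂ[X] :=
  LinearMap.mulLeft ℂ (X * (X - 1)) ∘ₗ derivative
    - (eExp m l k i : ℂ) • LinearMap.mulLeft ℂ (X - 1) - ((k : ℂ) + 1) • LinearMap.id

/-- `D_i^∨(l, k) = x d/dx - (∑_{s=i+1}^{r} m_s - l_{i+1} + l_i + r - i)`. -/
noncomputable def opDDual {r : ℕ} (m l : Fin r → ℕ) (k i : ℕ) : ℂ[X] →ₗ[ℂ] ℂ[X] :=
  LinearMap.mulLeft ℂ X ∘ₗ derivative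
    - ((∑ s : Fin r, if i ≤ (s : ℕ) then (m s : ℂ) else 0) - lExt l k (i + 1) + lExt l k i + r - i) •
      LinearMap.id

end TwoPointSpaces

/-! The pairing is evaluation of functionals in disguise. Fuchs' relation forces the Wronskian of
$V$ to be a nonzero constant times $T_1^r\cdots T_r$, so the cofactors of the last row of a
Wronskian matrix, divided by $T_1^{r-1}\cdots T_{r-1}$ and normalised, define a linear map $G:
V^*\to\mathbb C[x]$ (`HasFlags.exists_isDualMap`). It satisfies $\sum_j f_j^{(s)}G(f_j^*)=0$ for
$s<r$ and $=(-1)^rT_1\cdots T_r$ for $s=r$, whence $W^\dagger(f_1,\dots,f_r)=G\varphi$ with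
$\varphi=W^\dagger(\cdot,f_1,\dots,f_r)$ (`IsDualMap.wronskianDet_eq`). Thus $\langle
f,G\varphi\rangle=\varphi(f)$, and non-degeneracy is automatic once the image of $G$ is known to be
$U$.

Both $U$ and the image of $G$ equal the kernel of the hypergeometric operator
$H_{a,d}=\prod(\theta-a_j)-x\prod(\theta-d_j)$, $\theta=x\,d/dx$, where $a$, $d$ list the orders at
$0$ and the degrees. They lie in the kernel by an order and degree count on determinants
(`le_ker_hypergeometric`), and the recursion for coefficients bounds the dimension of the kernel
(`eq_ker_hypergeometric`). Passing from $(\boldsymbol l,k)$ to $(\boldsymbol l+\boldsymbol 1_i,k+1)$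
keeps $a$ and raises only $d_i$, by one, so $D_i^\vee=\theta-d_i'$ maps $U(\boldsymbol l+\boldsymbol
1_i,k+1)$ to $U(\boldsymbol l,k)$ by the contiguity $H_{a,d}(\theta-d'_i)=(\theta-d'_i)H_{a,d'}$.

The map $D: V\to V'$ is defined as the adjoint of $-D_i^\vee$, so that it lands in $V'$ for free;
what remains is $D=D_i$ (`adjoint_eq_opD`). The orthogonality relations for $G$ and $G'$ show that
$z=D_i-D$ satisfies $\sum_j z(f_j)G(f_j^*)^{(t)}=0$ for all $t<r$. Hence $z$ is multiplication by a
rational function (`IsDualMap.exists_mul_eq`), which is a polynomial $q$ because $V$ has no base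
points. The exponents at $1$ and at infinity leave only $q=0$ (`eq_zero_of_opD_sub_mul_mem`). -/

namespace TwoPointSpaces

/-! ### Wronskian determinants: change of basis, divisibility, degree -/

section Determinants

open Module Matrix

/-- The matrix with entries `L_s f_j`. -/
noncomputable def opMatrix {n : ℕ} (L : Fin n → ℂ[X] →ₗ[ℂ] ℂ[X]) (f : Fin n → ℂ[X]) :
    Matrix (Fin n) (Fin n) ℂ[X] :=
  Matrix.of fun s j => L s (f j)

/-- The Wronskian matrix. -/
noncomputable def wronskianMatrix {n : ℕ} (f : Fin n → ℂ[X]) : Matrix (Fin n) (Fin n) ℂ[X] :=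
  Matrix.of fun s j => derivative^[(s : ℕ)] (f j)

lemma wronskianMatrix_apply {n : ℕ} (f : Fin n → ℂ[X]) (s j : Fin n) :
    wronskianMatrix f s j = derivative^[(s : ℕ)] (f j) := rfl

lemma det_wronskianMatrix {n : ℕ} (f : Fin n → ℂ[X]) :
    (wronskianMatrix f).det = wronskianDet f := rfl

lemma opMatrix_derivative {n : ℕ} (f : Fin n → ℂ[X]) :
    opMatrix (fun s => (derivative : ℂ[X] →ₗ[ℂ] ℂ[X]) ^ (s : ℕ)) f = wronskianMatrix f := by
  ext1 s j
  simp [opMatrix, wronskianMatrix, Module.End.pow_apply]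

lemma opMatrix_eq_mul {n : ℕ} (L : Fin n → ℂ[X] →ₗ[ℂ] ℂ[X]) {V : Submodule ℂ ℂ[X]}
    (b : Basis (Fin n) ℂ V) (F : Fin n → V) :
    opMatrix L (fun j => (F j : ℂ[X])) =
      opMatrix L (fun j => (b j : ℂ[X])) * (b.toMatrix F).map C := by
  ext1 s j
  have h : (F j : ℂ[X]) = ∑ i, b.repr (F j) i • (b i : ℂ[X]) := by
    conv_lhs => rw [← b.sum_repr (F j)]
    simp only [Submodule.coe_sum, Submodule.coe_smul]
  simp only [opMatrix, Matrix.of_apply, Matrix.mul_apply, Matrix.map_apply, Basis.toMatrix_apply]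
  rw [h, map_sum]
  exact Finset.sum_congr rfl fun i _ => by rw [map_smul, smul_eq_C_mul, mul_comm]

lemma det_opMatrix_eq {n : ℕ} (L : Fin n → ℂ[X] →ₗ[ℂ] ℂ[X]) {V : Submodule ℂ ℂ[X]}
    (b : Basis (Fin n) ℂ V) (F : Fin n → V) :
    (opMatrix L (fun j => (F j : ℂ[X]))).det =
      C (b.det F) * (opMatrix L (fun j => (b j : ℂ[X]))).det := by
  rw [opMatrix_eq_mul L b F, det_mul, mul_comm, Basis.det_apply, RingHom.map_det]
  rfl

lemma wronskianDet_eq {n : ℕ} {V : Submodule ℂ ℂ[X]} (b : Basis (Fin n) ℂ V) (F : Fin n → V) :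
    wronskianDet (fun j => (F j : ℂ[X])) = C (b.det F) * wronskianDet (fun j => (b j : ℂ[X])) := by
  simpa only [opMatrix_derivative, det_wronskianMatrix] using
    det_opMatrix_eq (fun s : Fin n => (derivative : ℂ[X] →ₗ[ℂ] ℂ[X]) ^ (s : ℕ)) b F

lemma basis_det_ne_zero {n : ℕ} {V : Submodule ℂ ℂ[X]} (b b' : Basis (Fin n) ℂ V) :
    b.det b' ≠ 0 := (b.isUnit_det b').ne_zero

/-- Every term of the Leibniz expansion has the divisibility. The row weights `w` let $f^{(s)}$ be
treated as $p^sf^{(s)}$, which keeps the order of vanishing of $f$. -/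
lemma prod_dvd_det {ι R : Type*} [Fintype ι] [DecidableEq ι] [CommRing R] (N : Matrix ι ι R)
    (u v w : ι → R) (h : ∀ s j, u j * v s ∣ w s * N s j) :
    (∏ j, u j) * (∏ s, v s) ∣ (∏ s, w s) * N.det := by
  rw [det_apply, Finset.mul_sum]
  refine Finset.dvd_sum fun σ _ => ?_
  rw [mul_smul_comm]
  rw [Units.smul_def, zsmul_eq_mul]
  refine dvd_mul_of_dvd_right ?_ _
  rw [← Equiv.prod_comp σ v, ← Equiv.prod_comp σ w, ← Finset.prod_mul_distrib,
    ← Finset.prod_mul_distrib]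
  exact Finset.prod_dvd_prod_of_dvd _ _ fun i _ => h _ _

/-- The degree counterpart of `prod_dvd_det`: the weight $x^{\beta_s}$ compensates the drop of
degree in row $s$. -/
lemma natDegree_det_le {n : ℕ} (N : Matrix (Fin n) (Fin n) ℂ[X]) (α β : Fin n → ℕ)
    (h : ∀ s j, (X ^ β s * N s j).natDegree ≤ α j) :
    (X ^ (∑ s, β s) * N.det).natDegree ≤ ∑ j, α j := by
  rw [det_apply, Finset.mul_sum]
  refine natDegree_sum_le_of_forall_le _ _ fun σ _ => ?_
  rw [mul_smul_comm, Units.smul_def]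
  refine (natDegree_smul_le _ _).trans ?_
  rw [← Equiv.sum_comp σ β, ← Finset.prod_pow_eq_pow_sum, ← Finset.prod_mul_distrib]
  exact (natDegree_prod_le _ _).trans (Finset.sum_le_sum fun i _ => h _ _)

lemma coeff_prod_sum {ι : Type*} (S : Finset ι) (f : ι → ℂ[X]) (d : ι → ℕ)
    (h : ∀ i ∈ S, (f i).natDegree ≤ d i) :
    (∏ i ∈ S, f i).coeff (∑ i ∈ S, d i) = ∏ i ∈ S, (f i).coeff (d i) := by
  classical
  induction S using Finset.induction_on with
  | empty => simp
  | insert a S ha ih =>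
    rw [Finset.prod_insert ha, Finset.sum_insert ha, Finset.prod_insert ha,
      coeff_mul_add_eq_of_natDegree_le (h a (Finset.mem_insert_self _ _)),
      ih fun i hi => h i (Finset.mem_insert_of_mem hi)]
    exact (natDegree_prod_le _ _).trans
      (Finset.sum_le_sum fun i hi => h i (Finset.mem_insert_of_mem hi))

lemma coeff_det_sum {n : ℕ} (N : Matrix (Fin n) (Fin n) ℂ[X]) (d : Fin n → ℕ)
    (h : ∀ s j, (N s j).natDegree ≤ d j) :
    N.det.coeff (∑ j, d j) = (Matrix.of fun s j => (N s j).coeff (d j)).det := by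
  rw [det_apply, det_apply, finsetSum_coeff]
  refine Finset.sum_congr rfl fun σ _ => ?_
  rw [Units.smul_def, Units.smul_def, coeff_smul, coeff_prod_sum _ _ _ fun i _ => h _ _]
  rfl

lemma coeff_X_pow_mul_iterate_derivative (f : ℂ[X]) (s n : ℕ) :
    (X ^ s * derivative^[s] f).coeff n = n.descFactorial s * f.coeff n := by
  rw [coeff_X_pow_mul']
  split_ifs with h
  · rw [coeff_iterate_derivative, Nat.sub_add_cancel h, nsmul_eq_mul]
  · rw [Nat.descFactorial_of_lt (not_le.mp h)]
    simp

lemma natDegree_X_pow_mul_iterate_derivative_le (f : ℂ[X]) (s : ℕ) :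
    (X ^ s * derivative^[s] f).natDegree ≤ f.natDegree := by
  rw [natDegree_le_iff_coeff_eq_zero]
  intro N hN
  rw [coeff_X_pow_mul_iterate_derivative, coeff_eq_zero_of_natDegree_lt hN, mul_zero]

lemma pow_dvd_pow_mul_iterate_derivative {p f : ℂ[X]} {a : ℕ} (s : ℕ) (h : p ^ a ∣ f) :
    p ^ a ∣ p ^ s * derivative^[s] f := by
  refine (pow_dvd_pow p (show a ≤ s + (a - s) by omega)).trans ?_
  rw [pow_add]
  exact mul_dvd_mul_left _ (pow_sub_dvd_iterate_derivative_of_pow_dvd s h)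

/-- Polynomials of pairwise distinct degrees have a nonzero Wronskian. -/
lemma wronskianDet_ne_zero_of_natDegree_injective {n : ℕ} (f : Fin n → ℂ[X])
    (h0 : ∀ j, f j ≠ 0) (hd : Function.Injective fun j => (f j).natDegree) :
    wronskianDet f ≠ 0 := by
  intro hW
  have h1 := coeff_det_sum (Matrix.of fun s j : Fin n => X ^ (s : ℕ) * derivative^[(s : ℕ)] (f j))
    (fun j => (f j).natDegree) fun s j => natDegree_X_pow_mul_iterate_derivative_le _ _
  have h3 : (Matrix.of fun s j : Fin n => X ^ (s : ℕ) * derivative^[(s : ℕ)] (f j)).det = 0 := by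
    have h4 := det_mul_column (fun s : Fin n => (X : ℂ[X]) ^ (s : ℕ)) (wronskianMatrix f)
    rw [det_wronskianMatrix, hW, mul_zero] at h4
    exact h4
  rw [h3, coeff_zero] at h1
  -- The top coefficient of $x^sf_j^{(s)}$ is the leading coefficient of $f_j$ times a falling
  -- factorial of its degree. Falling factorials are monic of degree $s$, so a Vandermonde
  -- determinant in the degrees results.
  have h5 : (Matrix.of fun s j : Fin n =>
      ((Matrix.of fun s j : Fin n => X ^ (s : ℕ) * derivative^[(s : ℕ)] (f j)) s j).coeff
        (f j).natDegree) =
      Matrix.of fun s j : Fin n => (f j).leadingCoeff *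
        (Matrix.of fun i j : Fin n =>
          (descPochhammer ℂ (j : ℕ)).eval ((f i).natDegree : ℂ))ᵀ s j := by
    ext s j
    simp only [Matrix.of_apply, Matrix.transpose_apply]
    rw [coeff_X_pow_mul_iterate_derivative, descPochhammer_eval_eq_descFactorial, mul_comm]
    rfl
  rw [h5, det_mul_row, det_transpose,
    ← det_eval_matrixOfPolynomials_eq_det_vandermonde (fun j => ((f j).natDegree : ℂ))
      (fun j => descPochhammer ℂ (j : ℕ)) (fun j => descPochhammer_natDegree ℂ j)
      (fun j => monic_descPochhammer ℂ j)] at h1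
  refine mul_ne_zero ?_ ?_ h1.symm
  · exact Finset.prod_ne_zero_iff.mpr fun j _ => leadingCoeff_ne_zero.mpr (h0 j)
  · exact det_vandermonde_ne_zero_iff.mpr fun i j hij => hd (Nat.cast_injective hij)

lemma linearIndependent_of_wronskianDet_ne_zero {n : ℕ} (f : Fin n → ℂ[X])
    (h : wronskianDet f ≠ 0) : LinearIndependent ℂ f := by
  rw [Fintype.linearIndependent_iff]
  intro c hc
  have h1 : wronskianMatrix f *ᵥ (fun j => C (c j)) = 0 := by
    ext1 s
    have h2 : derivative^[(s : ℕ)] (∑ i, c i • f i) = 0 := by rw [hc]; simp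
    rw [iterate_derivative_sum] at h2
    rw [mulVec, dotProduct, Pi.zero_apply, ← h2]
    refine Finset.sum_congr rfl fun j _ => ?_
    rw [iterate_derivative_smul, smul_eq_C_mul, mul_comm]
    rfl
  have h2 := eq_zero_of_mulVec_eq_zero h h1
  intro i
  simpa using congrFun h2 i

/-- In a vanishing combination the term of least order at `z` would be divisible by a higher power
of $x-z$, being minus the sum of the others. -/
lemma linearIndependent_of_rootMultiplicity_injective {n : ℕ} (z : ℂ) (f : Fin n → ℂ[X])
    (h0 : ∀ j, f j ≠ 0) (hd : Function.Injective fun j => (f j).rootMultiplicity z) :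
    LinearIndependent ℂ f := by
  classical
  rw [Fintype.linearIndependent_iff]
  intro c hc
  by_contra! hne
  obtain ⟨i, hi, hmin⟩ := Finset.exists_min_image (Finset.univ.filter fun i => c i ≠ 0)
    (fun j => (f j).rootMultiplicity z) (by obtain ⟨i, hi⟩ := hne; exact ⟨i, by simpa using hi⟩)
  have hci : c i ≠ 0 := by simpa using hi
  have h1 : (X - C z) ^ ((f i).rootMultiplicity z + 1) ∣ c i • f i := by
    rw [← Finset.add_sum_erase _ _ (Finset.mem_univ i), add_eq_zero_iff_eq_neg] at hc
    rw [hc, dvd_neg]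
    refine Finset.dvd_sum fun j hj => ?_
    by_cases hcj : c j = 0
    · simp [hcj]
    · rw [smul_eq_C_mul]
      refine Dvd.dvd.trans (pow_dvd_pow _ ?_) ((pow_rootMultiplicity_dvd (f j) z).mul_left _)
      have h3 := hmin j (by simpa using hcj)
      have h4 : (f i).rootMultiplicity z ≠ (f j).rootMultiplicity z :=
        fun h => (Finset.ne_of_mem_erase hj) (hd h).symm
      omega
  have h2 : (X - C z) ^ ((f i).rootMultiplicity z + 1) ∣ f i := by
    have := h1.mul_left (C (c i)⁻¹)
    rwa [smul_eq_C_mul, ← mul_assoc, ← C_mul, inv_mul_cancel₀ hci, C_1, one_mul] at this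
  have := (le_rootMultiplicity_iff (h0 i)).mpr h2
  omega

lemma exists_basis {V : Submodule ℂ ℂ[X]} {n : ℕ} (hn : finrank ℂ V = n + 1)
    (f : Fin (n + 1) → ℂ[X]) (hf : ∀ i, f i ∈ V) (hli : LinearIndependent ℂ f) :
    ∃ b : Basis (Fin (n + 1)) ℂ V, ∀ i, (b i : ℂ[X]) = f i := by
  have hli' : LinearIndependent ℂ fun i => (⟨f i, hf i⟩ : V) :=
    LinearIndependent.of_comp V.subtype hli
  exact ⟨basisOfLinearIndependentOfCardEqFinrank hli' (by simp [hn]), fun i => by simp⟩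

end Determinants

/-! ### Bases adapted to 0, 1 and infinity; the Wronskian from Fuchs' relation -/

section Flags

open Module Matrix

lemma sum_exponent {r : ℕ} (n : Fin r → ℕ) (N : ℕ) :
    ∑ i ∈ Finset.range N, exponent n i =
      ∑ i ∈ Finset.range N, i + ∑ s : Fin r, n s * (N - ((s : ℕ) + 1)) := by
  induction N with
  | zero => simp
  | succ N ih =>
    rw [Finset.sum_range_succ, ih, Finset.sum_range_succ, exponent]
    have h : ∑ s : Fin r, n s * (N + 1 - ((s : ℕ) + 1)) =
        ∑ s : Fin r, n s * (N - ((s : ℕ) + 1)) + ∑ s : Fin r, if (s : ℕ) < N then n s else 0 := by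
      rw [← Finset.sum_add_distrib]
      refine Finset.sum_congr rfl fun s _ => ?_
      split_ifs with h
      · rw [show N + 1 - ((s : ℕ) + 1) = N - ((s : ℕ) + 1) + 1 by omega, mul_add, mul_one]
      · rw [show N + 1 - ((s : ℕ) + 1) = N - ((s : ℕ) + 1) by omega, add_zero]
    rw [h]
    ring

lemma exponent_strictMono {r : ℕ} (n : Fin r → ℕ) : StrictMono (exponent n) := by
  refine strictMono_nat_of_lt_succ fun i => ?_
  unfold exponent
  have : (∑ s : Fin r, if (s : ℕ) < i then n s else 0) ≤
      ∑ s : Fin r, if (s : ℕ) < i + 1 then n s else 0 := by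
    refine Finset.sum_le_sum fun s _ => ?_
    split_ifs <;> omega
  omega

/-- `T_1^{N-1} T_2^{N-2} ⋯ T_{N-1}` for `T_s = x^{n0_s} (x - 1)^{n1_s}`. -/
noncomputable def tau {r : ℕ} (n0 n1 : Fin r → ℕ) (N : ℕ) : ℂ[X] :=
  X ^ (∑ s : Fin r, n0 s * (N - ((s : ℕ) + 1))) *
    (X - C 1) ^ (∑ s : Fin r, n1 s * (N - ((s : ℕ) + 1)))

/-- `T_1 ⋯ T_r` for `T_s = x^{n0_s} (x - 1)^{n1_s}`. -/
noncomputable def tProd {r : ℕ} (n0 n1 : Fin r → ℕ) : ℂ[X] :=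
  X ^ (∑ s : Fin r, n0 s) * (X - C 1) ^ (∑ s : Fin r, n1 s)

lemma tau_monic {r : ℕ} (n0 n1 : Fin r → ℕ) (N : ℕ) : (tau n0 n1 N).Monic :=
  (monic_X_pow _).mul ((monic_X_sub_C _).pow _)

lemma natDegree_tau {r : ℕ} (n0 n1 : Fin r → ℕ) (N : ℕ) :
    (tau n0 n1 N).natDegree = ∑ s : Fin r, n0 s * (N - ((s : ℕ) + 1)) +
      ∑ s : Fin r, n1 s * (N - ((s : ℕ) + 1)) := by
  rw [tau, (monic_X_pow _).natDegree_mul ((monic_X_sub_C _).pow _), natDegree_X_pow,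
    (monic_X_sub_C _).natDegree_pow, natDegree_X_sub_C, mul_one]

lemma tProd_ne_zero {r : ℕ} (n0 n1 : Fin r → ℕ) : tProd n0 n1 ≠ 0 :=
  ((monic_X_pow _).mul ((monic_X_sub_C _).pow _)).ne_zero

lemma tau_succ {r : ℕ} (n0 n1 : Fin r → ℕ) :
    tau n0 n1 (r + 1) = tau n0 n1 r * tProd n0 n1 := by
  have h (n : Fin r → ℕ) : ∑ s : Fin r, n s * (r + 1 - ((s : ℕ) + 1)) =
      ∑ s : Fin r, n s * (r - ((s : ℕ) + 1)) + ∑ s : Fin r, n s := by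
    rw [← Finset.sum_add_distrib]
    refine Finset.sum_congr rfl fun s _ => ?_
    rw [show r + 1 - ((s : ℕ) + 1) = r - ((s : ℕ) + 1) + 1 by omega, mul_add, mul_one]
  rw [tau, tau, tProd, h, h, pow_add, pow_add]
  ring

lemma isCoprime_X_X_sub_one : IsCoprime (X : ℂ[X]) (X - C 1) := ⟨1, -1, by simp⟩

lemma mul_dvd_of_pow_dvd {p : ℂ[X]} {a b : ℕ} (h0 : X ^ a ∣ p) (h1 : (X - C 1) ^ b ∣ p) :
    X ^ a * (X - C 1) ^ b ∣ p :=
  (isCoprime_X_X_sub_one.pow).mul_dvd h0 h1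

/-- An `(r+1)`-dimensional space of polynomials with bases adapted to `0`, `1` and infinity,
for exponents subject to Fuchs' relation. -/
structure HasFlags {r : ℕ} (n0 n1 : Fin r → ℕ) (e : ℕ → ℕ) (V : Submodule ℂ ℂ[X]) : Prop where
  at_zero : ∃ b : Basis (Fin (r + 1)) ℂ V, ∀ i : Fin (r + 1), X ^ exponent n0 i ∣ (b i : ℂ[X])
  at_one : ∃ b : Basis (Fin (r + 1)) ℂ V, ∀ i : Fin (r + 1), (X - C 1) ^ exponent n1 i ∣ (b i : ℂ[X])
  at_infinity : ∃ b : Basis (Fin (r + 1)) ℂ V, ∀ i : Fin (r + 1), (b i : ℂ[X]).natDegree ≤ e i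
  wronskian : ∀ b : Basis (Fin (r + 1)) ℂ V, wronskianDet (fun j => (b j : ℂ[X])) ≠ 0
  fuchs : ∑ i ∈ Finset.range (r + 1), e i = ∑ i ∈ Finset.range (r + 1), i +
    ∑ s : Fin r, n0 s * (r + 1 - ((s : ℕ) + 1)) + ∑ s : Fin r, n1 s * (r + 1 - ((s : ℕ) + 1))

lemma exists_basis_of_exponentsAt {r : ℕ} {V : Submodule ℂ ℂ[X]} (hV : finrank ℂ V = r + 1)
    (z : ℂ) (n : Fin r → ℕ) (h : exponentsAt V z = {a | ∃ i ≤ r, a = exponent n i}) :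
    ∃ b : Basis (Fin (r + 1)) ℂ V, ∀ i : Fin (r + 1), (X - C z) ^ exponent n i ∣ (b i : ℂ[X]) := by
  have h1 (i : Fin (r + 1)) : ∃ f ∈ V, f ≠ 0 ∧ f.rootMultiplicity z = exponent n i := by
    have : exponent n i ∈ exponentsAt V z := h ▸ ⟨i, Nat.lt_succ_iff.mp i.2, rfl⟩
    exact this
  choose f hfV hf0 hf using h1
  obtain ⟨b, hb⟩ := exists_basis hV f hfV (linearIndependent_of_rootMultiplicity_injective z f hf0
    fun i j hij => by
      simp only [hf] at hij
      exact Fin.ext ((exponent_strictMono n).injective hij))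
  exact ⟨b, fun i => by rw [hb, ← hf]; exact pow_rootMultiplicity_dvd _ _⟩

lemma HasExponents.exists_basis_natDegree {r : ℕ} {n0 n1 : Fin r → ℕ} {e' : ℕ → ℤ}
    {V : Submodule ℂ ℂ[X]} (hV : HasExponents n0 n1 e' V) {e : ℕ → ℕ} (he : ∀ i ≤ r, e' i = e i)
    (hinj : ∀ i ≤ r, ∀ j ≤ r, e i = e j → i = j) :
    (∃ b : Basis (Fin (r + 1)) ℂ V, ∀ i : Fin (r + 1), (b i : ℂ[X]).natDegree = e i) ∧
      ∀ b : Basis (Fin (r + 1)) ℂ V, wronskianDet (fun j => (b j : ℂ[X])) ≠ 0 := by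
  have h1 (i : Fin (r + 1)) : ∃ f ∈ V, f ≠ 0 ∧ f.natDegree = e i := by
    have : e i ∈ exponentsAtInfinity V :=
      hV.at_infinity ▸ ⟨i, Nat.lt_succ_iff.mp i.2, (he i (Nat.lt_succ_iff.mp i.2)).symm⟩
    exact this
  choose f hfV hf0 hf using h1
  have hW : wronskianDet f ≠ 0 := wronskianDet_ne_zero_of_natDegree_injective f hf0
    fun i j hij => by
      simp only [hf] at hij
      exact Fin.ext (hinj _ (Nat.lt_succ_iff.mp i.2) _ (Nat.lt_succ_iff.mp j.2) hij)
  obtain ⟨b, hb⟩ := exists_basis hV.finrank_eq f hfV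
    (linearIndependent_of_wronskianDet_ne_zero f hW)
  refine ⟨⟨b, fun i => by rw [hb, hf]⟩, fun b' => ?_⟩
  rw [wronskianDet_eq b]
  refine mul_ne_zero (C_ne_zero.mpr (basis_det_ne_zero _ _)) ?_
  simpa only [hb] using hW

lemma HasExponents.exists_basis_at_zero {r : ℕ} {n0 n1 : Fin r → ℕ} {e' : ℕ → ℤ}
    {V : Submodule ℂ ℂ[X]} (hV : HasExponents n0 n1 e' V) :
    ∃ b : Basis (Fin (r + 1)) ℂ V, ∀ i : Fin (r + 1), X ^ exponent n0 i ∣ (b i : ℂ[X]) := by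
  simpa using exists_basis_of_exponentsAt hV.finrank_eq 0 n0 hV.at_zero

lemma HasExponents.hasFlags {r : ℕ} {n0 n1 : Fin r → ℕ} {e' : ℕ → ℤ} {V : Submodule ℂ ℂ[X]}
    (hV : HasExponents n0 n1 e' V) {e : ℕ → ℕ} (he : ∀ i ≤ r, e' i = e i)
    (hinj : ∀ i ≤ r, ∀ j ≤ r, e i = e j → i = j)
    (hsum : ∑ i ∈ Finset.range (r + 1), e i = ∑ i ∈ Finset.range (r + 1), i +
      ∑ s : Fin r, n0 s * (r + 1 - ((s : ℕ) + 1)) +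
        ∑ s : Fin r, n1 s * (r + 1 - ((s : ℕ) + 1))) :
    HasFlags n0 n1 e V := by
  obtain ⟨⟨b, hb⟩, hW⟩ := hV.exists_basis_natDegree he hinj
  exact ⟨hV.exists_basis_at_zero, exists_basis_of_exponentsAt hV.finrank_eq 1 n1 hV.at_one,
    ⟨b, fun i => (hb i).le⟩, hW, hsum⟩

variable {r : ℕ} {n0 n1 : Fin r → ℕ} {e : ℕ → ℕ} {V : Submodule ℂ ℂ[X]}

/-- The Wronskian of a space of polynomials with given exponents. -/
lemma HasFlags.exists_wronskianDet_eq (hV : HasFlags n0 n1 e V) (b : Basis (Fin (r + 1)) ℂ V) :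
    ∃ κ : ℂ, κ ≠ 0 ∧ wronskianDet (fun j => (b j : ℂ[X])) = C κ * tau n0 n1 (r + 1) := by
  -- An adapted basis gives order at least $\sum_i(\text{exponent}_i-i)$ at the point, which is the
  -- exponent in `tau`.
  have hdvd (p : ℂ[X]) (hp : p ≠ 0) (n : Fin r → ℕ)
      (h : ∃ b : Basis (Fin (r + 1)) ℂ V,
        ∀ i : Fin (r + 1), p ^ exponent n i ∣ (b i : ℂ[X])) :
      p ^ (∑ s : Fin r, n s * (r + 1 - ((s : ℕ) + 1))) ∣ wronskianDet fun j => (b j : ℂ[X]) := by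
    obtain ⟨c, hc⟩ := h
    have h1 := prod_dvd_det (wronskianMatrix fun j => (c j : ℂ[X]))
      (fun j => p ^ exponent n j) 1 (fun s => p ^ (s : ℕ)) fun s j => by
        rw [Pi.one_apply, mul_one]
        exact pow_dvd_pow_mul_iterate_derivative _ (hc j)
    rw [Finset.prod_pow_eq_pow_sum, Finset.prod_pow_eq_pow_sum, Fin.sum_univ_eq_sum_range,
      Fin.sum_univ_eq_sum_range (fun i => i), sum_exponent, pow_add, det_wronskianMatrix] at h1
    simp only [Pi.one_apply, Finset.prod_const_one, mul_one] at h1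
    rw [wronskianDet_eq c]
    exact ((mul_dvd_mul_iff_left (pow_ne_zero _ hp)).mp h1).mul_left _
  -- Fuchs' relation says that the degree bound from infinity equals the degree of the forced
  -- divisor `tau`, so the quotient is constant.
  have hdeg : (wronskianDet fun j => (b j : ℂ[X])).natDegree ≤ (tau n0 n1 (r + 1)).natDegree := by
    obtain ⟨c, hc⟩ := hV.at_infinity
    have h1 := natDegree_det_le (wronskianMatrix fun j => (c j : ℂ[X])) (fun j => e j)
      (fun s => (s : ℕ)) fun s j =>
        (natDegree_X_pow_mul_iterate_derivative_le _ _).trans (hc j)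
    rw [Fin.sum_univ_eq_sum_range, Fin.sum_univ_eq_sum_range (fun i => i), hV.fuchs,
      det_wronskianMatrix, natDegree_X_pow_mul _ (hV.wronskian c)] at h1
    rw [wronskianDet_eq c, natDegree_C_mul (basis_det_ne_zero _ _), natDegree_tau]
    omega
  obtain ⟨q, hq⟩ := mul_dvd_of_pow_dvd (hdvd X X_ne_zero n0 hV.at_zero)
    (hdvd (X - C 1) (X_sub_C_ne_zero 1) n1 hV.at_one)
  have hW := hV.wronskian b
  change _ = tau n0 n1 (r + 1) * q at hq
  have hq0 : q ≠ 0 := fun h => hW (by rw [hq, h, mul_zero])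
  rw [hq, (tau_monic _ _ _).natDegree_mul' hq0] at hdeg
  rw [hq]
  obtain ⟨κ, rfl⟩ := natDegree_eq_zero.mp (show q.natDegree = 0 by omega)
  exact ⟨κ, C_ne_zero.mp hq0, mul_comm _ _⟩

end Flags

/-! ### The dual map G and divided Wronskians of r functions -/

section Duality

open Module Matrix

lemma wronskianMatrix_eq_mul {n : ℕ} {V : Submodule ℂ ℂ[X]} (b : Basis (Fin n) ℂ V)
    (F : Fin n → V) :
    wronskianMatrix (fun j => (F j : ℂ[X])) =
      wronskianMatrix (fun j => (b j : ℂ[X])) * (b.toMatrix F).map C := by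
  simpa only [opMatrix_derivative] using
    opMatrix_eq_mul (fun s : Fin n => (derivative : ℂ[X] →ₗ[ℂ] ℂ[X]) ^ (s : ℕ)) b F

variable {r : ℕ} {n0 n1 : Fin r → ℕ} {e : ℕ → ℕ} {V : Submodule ℂ ℂ[X]}

lemma dvd_adjugate_of_basis (b b' : Basis (Fin (r + 1)) ℂ V) {p : ℂ[X]} (t : Fin (r + 1))
    (h : ∀ i, p ∣ (wronskianMatrix fun j => (b j : ℂ[X])).adjugate i t) (i : Fin (r + 1)) :
    p ∣ (wronskianMatrix fun j => (b' j : ℂ[X])).adjugate i t := by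
  rw [wronskianMatrix_eq_mul b b', adjugate_mul_distrib, mul_apply]
  exact Finset.dvd_sum fun j _ => (h j).mul_left _

/-- The cofactor is the determinant with last row replaced by the $i$-th unit vector. Its order is
at least the sum of the exponents other than the $i$-th, minus $0+1+\dots+(r-1)$. -/
lemma pow_dvd_adjugate {p : ℂ[X]} (hp : p ≠ 0) (n : Fin r → ℕ) (f : Fin (r + 1) → ℂ[X])
    (h : ∀ i : Fin (r + 1), p ^ exponent n i ∣ f i) (i : Fin (r + 1)) :
    p ^ (exponent n r - exponent n i + ∑ s : Fin r, n s * (r - ((s : ℕ) + 1))) ∣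
      (wronskianMatrix f).adjugate i (Fin.last r) := by
  have h1 := prod_dvd_det ((wronskianMatrix f).updateRow (Fin.last r) (Pi.single i 1))
    (fun j => p ^ exponent n j) 1
    (fun s => if s = Fin.last r then p ^ exponent n i else p ^ (s : ℕ)) fun s j => by
      rw [Pi.one_apply, mul_one]
      split_ifs with hs
      · subst hs
        rw [updateRow_self]
        by_cases hj : j = i
        · subst hj; simp
        · simp [Pi.single_eq_of_ne hj]
      · rw [updateRow_ne hs]
        exact pow_dvd_pow_mul_iterate_derivative _ (h j)
  simp only [← adjugate_apply, Pi.one_apply, Finset.prod_const_one, mul_one] at h1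
  rw [Finset.prod_pow_eq_pow_sum, Fin.prod_univ_castSucc] at h1
  simp only [Fin.castSucc_ne_last, if_false,
    if_true, Fin.val_castSucc] at h1
  rw [Finset.prod_pow_eq_pow_sum, Fin.sum_univ_eq_sum_range,
    Fin.sum_univ_eq_sum_range (fun i => i), Finset.sum_range_succ, sum_exponent, ← pow_add] at h1
  have h2 := (exponent_strictMono n).monotone (Nat.lt_succ_iff.mp i.2)
  rw [show ∑ i ∈ Finset.range r, i + ∑ s : Fin r, n s * (r - ((s : ℕ) + 1)) + exponent n r =
    (∑ i ∈ Finset.range r, i + exponent n i) +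
      (exponent n r - exponent n i + ∑ s : Fin r, n s * (r - ((s : ℕ) + 1))) by omega,
    pow_add] at h1
  exact (mul_dvd_mul_iff_left (pow_ne_zero _ hp)).mp h1

lemma natDegree_adjugate_le (f : Fin (r + 1) → ℂ[X])
    (h : ∀ i : Fin (r + 1), (f i).natDegree ≤ e i) (i : Fin (r + 1)) :
    (X ^ (∑ s ∈ Finset.range r, s + e i) *
      (wronskianMatrix f).adjugate i (Fin.last r)).natDegree ≤
        ∑ j ∈ Finset.range (r + 1), e j := by
  have h1 := natDegree_det_le ((wronskianMatrix f).updateRow (Fin.last r) (Pi.single i 1))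
    (fun j => e j) (fun s => if s = Fin.last r then e i else (s : ℕ)) fun s j => by
      split_ifs with hs
      · subst hs
        rw [updateRow_self]
        by_cases hj : j = i
        · subst hj; simp
        · simp [Pi.single_eq_of_ne hj]
      · rw [updateRow_ne hs]
        exact (natDegree_X_pow_mul_iterate_derivative_le _ _).trans (h j)
  rw [← adjugate_apply, Fin.sum_univ_castSucc] at h1
  simp only [Fin.castSucc_ne_last, if_false, if_true, Fin.val_castSucc] at h1
  rwa [Fin.sum_univ_eq_sum_range, Fin.sum_univ_eq_sum_range (fun i => i)] at h1

/-- A linear map `G` from the dual of `V` to polynomials with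
`∑ f_i^{(s)} G(f_i^*) = 0` for `s < r` and `∑ f_i^{(r)} G(f_i^*) = (-1)^r T_1 ⋯ T_r`. -/
def IsDualMap {r : ℕ} (n0 n1 : Fin r → ℕ) {V : Submodule ℂ ℂ[X]} (G : Dual ℂ V →ₗ[ℂ] ℂ[X]) :
    Prop :=
  ∀ (b : Basis (Fin (r + 1)) ℂ V) (s : Fin (r + 1)),
    ∑ i, derivative^[(s : ℕ)] (b i : ℂ[X]) * G (b.coord i) =
      if s = Fin.last r then (-1) ^ r * tProd n0 n1 else 0

/-- The sum is the image of the canonical element $\sum_i b_i\otimes b_i^*$, hence independent of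
the basis. -/
lemma sum_mul_coord_eq {n : ℕ} (b b' : Basis (Fin n) ℂ V) (L : V →ₗ[ℂ] ℂ[X])
    (G : Dual ℂ V →ₗ[ℂ] ℂ[X]) :
    ∑ i, L (b i) * G (b.coord i) = ∑ i, L (b' i) * G (b'.coord i) := by
  have h1 (i : Fin n) : G (b.coord i) = ∑ j, b.coord i (b' j) • G (b'.coord j) := by
    conv_lhs => rw [← b'.sum_dual_apply_smul_coord (b.coord i)]
    rw [map_sum]
    simp_rw [map_smul]
  have h2 (j : Fin n) : L (b' j) = ∑ i, b.coord i (b' j) • L (b i) := by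
    conv_lhs => rw [← b.sum_repr (b' j)]
    rw [map_sum]
    simp_rw [map_smul]
    rfl
  simp_rw [h1, h2, Finset.mul_sum, Finset.sum_mul]
  rw [Finset.sum_comm]
  simp_rw [mul_smul_comm, smul_mul_assoc]

/-- The dual map exists. -/
lemma HasFlags.exists_isDualMap (hV : HasFlags n0 n1 e V) :
    ∃ G : Dual ℂ V →ₗ[ℂ] ℂ[X], IsDualMap n0 n1 G := by
  obtain ⟨b, hb⟩ := hV.at_zero
  obtain ⟨b1, hb1⟩ := hV.at_one
  obtain ⟨κ, hκ, hW⟩ := hV.exists_wronskianDet_eq b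
  set M := wronskianMatrix fun j => (b j : ℂ[X]) with hM
  -- The orders at $0$ are read off in the basis `b`; those at $1$ are visible in another basis `b1`
  -- and are transferred to `b`.
  have hdvd (i : Fin (r + 1)) : tau n0 n1 r ∣ M.adjugate i (Fin.last r) := by
    refine mul_dvd_of_pow_dvd ?_ ?_
    · refine (pow_dvd_pow _ ?_).trans (pow_dvd_adjugate X_ne_zero n0 _ hb i)
      omega
    · refine dvd_adjugate_of_basis b1 b _ (fun i => ?_) i
      refine (pow_dvd_pow _ ?_).trans (pow_dvd_adjugate (X_sub_C_ne_zero 1) n1 _ hb1 i)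
      omega
  choose h hh using hdvd
  let G : Dual ℂ V →ₗ[ℂ] ℂ[X] := b.dualBasis.constr ℂ fun i => C ((-1) ^ r * κ⁻¹) * h i
  have hG (i : Fin (r + 1)) : G (b.coord i) = C ((-1) ^ r * κ⁻¹) * h i := by
    have := b.dualBasis.constr_basis ℂ (fun i => C ((-1) ^ r * κ⁻¹) * h i) i
    rwa [Basis.coe_dualBasis] at this
  refine ⟨G, fun b' s => ?_⟩
  have h1 := sum_mul_coord_eq b' b (((derivative : ℂ[X] →ₗ[ℂ] ℂ[X]) ^ (s : ℕ)) ∘ₗ V.subtype) G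
  simp only [LinearMap.comp_apply, Module.End.pow_apply, Submodule.subtype_apply] at h1
  rw [h1]
  simp_rw [hG]
  -- The relations defining a dual map are the last column of $M\,\mathrm{adj}(M)=\det M\cdot 1$,
  -- divided by `tau n0 n1 r`.
  have h2 : (M * M.adjugate) s (Fin.last r) = M.det * (1 : Matrix _ _ ℂ[X]) s (Fin.last r) := by
    rw [mul_adjugate]; rfl
  rw [mul_apply, hM, det_wronskianMatrix, hW, ← hM] at h2
  simp_rw [hh] at h2
  refine mul_left_cancel₀ (tau_monic n0 n1 r).ne_zero ?_
  have h3 : tau n0 n1 r * ∑ i, derivative^[(s : ℕ)] (b i : ℂ[X]) * (C ((-1) ^ r * κ⁻¹) * h i) =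
      C ((-1) ^ r * κ⁻¹) * ∑ i, M s i * (tau n0 n1 r * h i) := by
    rw [Finset.mul_sum, Finset.mul_sum]
    refine Finset.sum_congr rfl fun i _ => ?_
    rw [hM, wronskianMatrix_apply]
    ring
  rw [h3, h2, tau_succ, ← mul_assoc, ← mul_assoc, ← C_mul, mul_assoc ((-1) ^ r),
    inv_mul_cancel₀ hκ, mul_one, one_apply]
  split_ifs
  · simp only [C_pow, C_neg, C_1]; ring
  · simp

variable {G : Dual ℂ V →ₗ[ℂ] ℂ[X]}

/-- Differentiating the relation for $(s,t)$ with $s+t<r$ moves one derivative from the first factor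
to the second, at the cost of a sign. -/
lemma IsDualMap.sum_derivative (hG : IsDualMap n0 n1 G) (b : Basis (Fin (r + 1)) ℂ V)
    (s t : ℕ) (hst : s + t ≤ r) :
    ∑ i, derivative^[s] (b i : ℂ[X]) * derivative^[t] (G (b.coord i)) =
      if s + t = r then (-1) ^ (r + t) * tProd n0 n1 else 0 := by
  induction t generalizing s with
  | zero =>
    have h := hG b ⟨s, by omega⟩
    simp only [Fin.ext_iff, Fin.val_last] at h
    simpa using h
  | succ t ih =>
    have h := congrArg derivative (ih s (by omega))
    rw [if_neg (by omega), derivative_sum, derivative_zero] at h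
    simp_rw [derivative_mul, ← Function.iterate_succ_apply'] at h
    rw [Finset.sum_add_distrib, ih (s + 1) (by omega)] at h
    rw [eq_neg_of_add_eq_zero_right h, show s + 1 + t = s + (t + 1) by ring]
    split_ifs
    · ring
    · simp

/-- The Wronskian matrix of $V$ times the transposed one of the $G(b_i^*)$ vanishes above the
antidiagonal and has $\pm T_1\cdots T_r$ on it, so its determinant is nonzero. -/
lemma IsDualMap.wronskianDet_ne_zero (hG : IsDualMap n0 n1 G) (b : Basis (Fin (r + 1)) ℂ V) :
    wronskianDet (fun i => G (b.coord i)) ≠ 0 := by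
  intro h0
  set Q := wronskianMatrix (fun j => (b j : ℂ[X])) * (wronskianMatrix fun i => G (b.coord i))ᵀ
    with hQ
  have hdet : Q.det = 0 := by
    rw [hQ, det_mul, det_transpose, det_wronskianMatrix, det_wronskianMatrix, h0, mul_zero]
  have happ (s t : Fin (r + 1)) (hst : (s : ℕ) + t ≤ r) :
      Q s t = if (s : ℕ) + t = r then (-1) ^ (r + (t : ℕ)) * tProd n0 n1 else 0 := by
    rw [← hG.sum_derivative b s t hst]; rfl
  have htri : (Q.submatrix Fin.revPerm id).BlockTriangular id := by
    intro s t hst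
    have hst' : t < s := hst
    rw [submatrix_apply, Fin.revPerm_apply, id, happ _ _ (by rw [Fin.val_rev]; omega),
      if_neg (by rw [Fin.val_rev]; omega)]
  have h1 := det_of_isUpperTriangular htri
  rw [det_permute, hdet, mul_zero] at h1
  refine Finset.prod_ne_zero_iff.mpr (fun i _ => ?_) h1.symm
  rw [submatrix_apply, Fin.revPerm_apply, id, happ _ _ (by rw [Fin.val_rev]; omega),
      if_pos (by rw [Fin.val_rev]; omega)]
  exact mul_ne_zero (pow_ne_zero _ (by simp)) (tProd_ne_zero _ _)

lemma IsDualMap.injective (hG : IsDualMap n0 n1 G) (b : Basis (Fin (r + 1)) ℂ V) :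
    Function.Injective G := by
  rw [← LinearMap.ker_eq_bot, LinearMap.ker_eq_bot']
  intro φ hφ
  have h1 := Fintype.linearIndependent_iff.mp
    (linearIndependent_of_wronskianDet_ne_zero _ (hG.wronskianDet_ne_zero b)) (fun i => φ (b i)) (by
      rw [← hφ]
      conv_rhs => rw [← b.sum_dual_apply_smul_coord φ]
      rw [map_sum]
      simp_rw [map_smul])
  exact b.ext fun i => by simpa using h1 i

/-- The relations of a dual map form a linear system with the Wronskian matrix, so any dual map
consists of cofactors. The order and degree bounds for $G$ below follow from those for cofactors. -/
lemma HasFlags.exists_adjugate_eq (hV : HasFlags n0 n1 e V) (hG : IsDualMap n0 n1 G)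
    (b : Basis (Fin (r + 1)) ℂ V) :
    ∃ κ : ℂ, κ ≠ 0 ∧ ∀ i, (wronskianMatrix fun j => (b j : ℂ[X])).adjugate i (Fin.last r) =
      C κ * (tau n0 n1 r * G (b.coord i)) := by
  obtain ⟨κ, hκ, hW⟩ := hV.exists_wronskianDet_eq b
  set M := wronskianMatrix fun j => (b j : ℂ[X]) with hM
  refine ⟨(-1) ^ r * κ, mul_ne_zero (pow_ne_zero _ (by simp)) hκ, fun i => ?_⟩
  have h1 : M *ᵥ (fun i => G (b.coord i)) = Pi.single (Fin.last r) ((-1) ^ r * tProd n0 n1) := by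
    ext1 s
    rw [Pi.single_apply]
    exact hG b s
  have h2 := congrArg (fun v => (M.adjugate *ᵥ v) i) h1
  simp only [mulVec_mulVec, adjugate_mul, smul_mulVec, one_mulVec, Pi.smul_apply, smul_eq_mul,
    mulVec_single, MulOpposite.smul_eq_mul_unop, MulOpposite.unop_op, col_apply] at h2
  rw [hM, det_wronskianMatrix, hW, ← hM, tau_succ] at h2
  have h3 : ((-1 : ℂ[X]) ^ r) * (-1) ^ r = 1 := by rw [← mul_pow]; simp
  refine mul_right_cancel₀ (tProd_ne_zero n0 n1) ?_
  simp only [C_mul, C_pow, C_neg, C_1]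
  linear_combination (-(-1 : ℂ[X]) ^ r) * h2 - M.adjugate i (Fin.last r) * tProd n0 n1 * h3

lemma HasFlags.X_pow_dvd_dual (hV : HasFlags n0 n1 e V) (hG : IsDualMap n0 n1 G)
    (b : Basis (Fin (r + 1)) ℂ V) (hb : ∀ i : Fin (r + 1), X ^ exponent n0 i ∣ (b i : ℂ[X]))
    (i : Fin (r + 1)) : X ^ (exponent n0 r - exponent n0 i) ∣ G (b.coord i) := by
  obtain ⟨κ, hκ, h⟩ := hV.exists_adjugate_eq hG b
  have h1 := pow_dvd_adjugate X_ne_zero n0 _ hb i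
  rw [h, (isUnit_C.mpr hκ.isUnit).dvd_mul_left, tau, mul_assoc, add_comm, pow_add,
    mul_dvd_mul_iff_left (pow_ne_zero _ X_ne_zero)] at h1
  exact isCoprime_X_X_sub_one.pow.dvd_of_dvd_mul_left h1

lemma HasFlags.X_sub_one_pow_dvd_dual (hV : HasFlags n0 n1 e V) (hG : IsDualMap n0 n1 G)
    (b : Basis (Fin (r + 1)) ℂ V)
    (hb : ∀ i : Fin (r + 1), (X - C 1) ^ exponent n1 i ∣ (b i : ℂ[X]))
    (i : Fin (r + 1)) : (X - C 1) ^ (exponent n1 r - exponent n1 i) ∣ G (b.coord i) := by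
  obtain ⟨κ, hκ, h⟩ := hV.exists_adjugate_eq hG b
  have h1 := pow_dvd_adjugate (X_sub_C_ne_zero 1) n1 _ hb i
  rw [h, (isUnit_C.mpr hκ.isUnit).dvd_mul_left, tau, mul_comm (X ^ _), mul_assoc, add_comm,
    pow_add, mul_dvd_mul_iff_left (pow_ne_zero _ (X_sub_C_ne_zero 1))] at h1
  exact isCoprime_X_X_sub_one.symm.pow.dvd_of_dvd_mul_left h1

lemma HasFlags.natDegree_dual_le (hV : HasFlags n0 n1 e V) (hG : IsDualMap n0 n1 G)
    (b : Basis (Fin (r + 1)) ℂ V) (hb : ∀ i : Fin (r + 1), (b i : ℂ[X]).natDegree ≤ e i)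
    (i : Fin (r + 1)) :
    (G (b.coord i)).natDegree ≤ r + ∑ s, n0 s + ∑ s, n1 s - e i := by
  obtain ⟨κ, hκ, h⟩ := hV.exists_adjugate_eq hG b
  have h1 := natDegree_adjugate_le _ hb i
  by_cases h0 : G (b.coord i) = 0
  · simp [h0]
  have h2 := (tau_monic n0 n1 r).ne_zero
  rw [h, natDegree_X_pow_mul _ (mul_ne_zero (C_ne_zero.mpr hκ) (mul_ne_zero h2 h0)),
    natDegree_C_mul hκ, (tau_monic n0 n1 r).natDegree_mul' h0, hV.fuchs,
    Finset.sum_range_succ] at h1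
  have h3 : (tau n0 n1 (r + 1)).natDegree =
      (tau n0 n1 r).natDegree + (∑ s, n0 s + ∑ s, n1 s) := by
    rw [tau_succ, (tau_monic _ _ _).natDegree_mul' (tProd_ne_zero _ _), tProd,
      (monic_X_pow _).natDegree_mul ((monic_X_sub_C _).pow _), natDegree_X_pow,
      (monic_X_sub_C _).natDegree_pow, natDegree_X_sub_C, mul_one]
  rw [natDegree_tau n0 n1 (r + 1)] at h3
  omega

/-- Expand $W(b_i,F_1,\dots,F_r)$ along its first column, multiply by $G(b_i^*)$ and sum over $i$:
only the row $s=r$ survives, with minor $W(F_1,\dots,F_r)$. -/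
lemma IsDualMap.wronskianDet_eq (hG : IsDualMap n0 n1 G) (b : Basis (Fin (r + 1)) ℂ V)
    (F : Fin r → V) (φ : Dual ℂ V)
    (h : ∀ f : V, wronskianDet (Fin.cons (f : ℂ[X]) fun j => (F j : ℂ[X])) =
      C (φ f) * tau n0 n1 (r + 1)) :
    wronskianDet (fun j => (F j : ℂ[X])) = tau n0 n1 r * G φ := by
  have hexp (f : V) : wronskianDet (Fin.cons (f : ℂ[X]) fun j => (F j : ℂ[X])) =
      ∑ s : Fin (r + 1), (-1) ^ (s : ℕ) * derivative^[(s : ℕ)] (f : ℂ[X]) *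
        (Matrix.of fun i j : Fin r => derivative^[(s.succAbove i : ℕ)] (F j : ℂ[X])).det := by
    rw [wronskianDet, det_succ_column_zero]
    rfl
  have h1 : G φ = ∑ i, C (φ (b i)) * G (b.coord i) := by
    conv_lhs => rw [← b.sum_dual_apply_smul_coord φ]
    rw [map_sum]
    simp_rw [map_smul, smul_eq_C_mul]
  have h2 : ∑ i, wronskianDet (Fin.cons (b i : ℂ[X]) fun j => (F j : ℂ[X])) * G (b.coord i) =
      tau n0 n1 (r + 1) * G φ := by
    rw [h1, Finset.mul_sum]
    refine Finset.sum_congr rfl fun i _ => ?_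
    rw [h]; ring
  simp_rw [hexp, Finset.sum_mul] at h2
  rw [Finset.sum_comm] at h2
  have h3 (s : Fin (r + 1)) : ∑ i, (-1) ^ (s : ℕ) * derivative^[(s : ℕ)] (b i : ℂ[X]) *
        (Matrix.of fun i j : Fin r => derivative^[(s.succAbove i : ℕ)] (F j : ℂ[X])).det *
          G (b.coord i) = if s = Fin.last r then
            tProd n0 n1 * wronskianDet (fun j => (F j : ℂ[X])) else 0 := by
    have h4 := hG b s
    have h5 : ∑ i, (-1) ^ (s : ℕ) * derivative^[(s : ℕ)] (b i : ℂ[X]) *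
        (Matrix.of fun i j : Fin r => derivative^[(s.succAbove i : ℕ)] (F j : ℂ[X])).det *
          G (b.coord i) = (-1) ^ (s : ℕ) *
        (Matrix.of fun i j : Fin r => derivative^[(s.succAbove i : ℕ)] (F j : ℂ[X])).det *
        ∑ i, derivative^[(s : ℕ)] (b i : ℂ[X]) * G (b.coord i) := by
      rw [Finset.mul_sum]
      exact Finset.sum_congr rfl fun i _ => by ring
    rw [h5, h4]
    split_ifs with hs
    · subst hs
      have h6 : ((-1 : ℂ[X]) ^ r) * (-1) ^ r = 1 := by rw [← mul_pow]; simp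
      simp only [Fin.succAbove_last, Fin.val_castSucc, Fin.val_last, wronskianDet]
      linear_combination (tProd n0 n1 *
        (Matrix.of fun i j : Fin r => derivative^[(i : ℕ)] (F j : ℂ[X])).det) * h6
    · simp
  simp_rw [h3] at h2
  rw [Finset.sum_ite_eq' Finset.univ, if_pos (Finset.mem_univ _), tau_succ] at h2
  exact mul_left_cancel₀ (tProd_ne_zero n0 n1) (by rw [h2]; ring)

lemma wronskianDet_cons_eq (b : Basis (Fin (r + 1)) ℂ V) (f : V) (F : Fin r → V) :
    wronskianDet (Fin.cons (f : ℂ[X]) fun j => (F j : ℂ[X])) =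
      C (b.det (Fin.cons f F)) * wronskianDet fun j => (b j : ℂ[X]) := by
  rw [← TwoPointSpaces.wronskianDet_eq b]
  congr 1
  ext1 j
  cases j using Fin.cases <;> rfl

lemma HasFlags.exists_functional (hV : HasFlags n0 n1 e V) (F : Fin r → V) :
    ∃ φ : Dual ℂ V, ∀ f : V, wronskianDet (Fin.cons (f : ℂ[X]) fun j => (F j : ℂ[X])) =
      C (φ f) * tau n0 n1 (r + 1) := by
  obtain ⟨b, -⟩ := hV.at_zero
  obtain ⟨κ, hκ, hW⟩ := hV.exists_wronskianDet_eq b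
  refine ⟨κ • b.det.toMultilinearMap.toLinearMap (Fin.cons 0 F) 0, fun f => ?_⟩
  rw [wronskianDet_cons_eq b, hW, ← mul_assoc, ← C_mul, mul_comm _ κ]
  simp [Fin.update_cons_zero]

/-- For $\varphi\ne0$ a basis of $\ker\varphi$ serves as $F$, after one vector is rescaled; this
rescaling needs $r>0$. With `exists_functional` it makes the divided Wronskians exactly the image of
$G$. -/
lemma HasFlags.exists_family (hV : HasFlags n0 n1 e V) (hr : 0 < r) (φ : Dual ℂ V) :
    ∃ F : Fin r → V, ∀ f : V, wronskianDet (Fin.cons (f : ℂ[X]) fun j => (F j : ℂ[X])) =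
      C (φ f) * tau n0 n1 (r + 1) := by
  by_cases h0 : φ = 0
  · refine ⟨0, fun f => ?_⟩
    rw [wronskianDet, det_eq_zero_of_column_eq_zero (Fin.succ ⟨0, hr⟩) fun i => ?_]
    · simp [h0]
    · rw [Matrix.of_apply, Fin.cons_succ]
      simp
  obtain ⟨c, -⟩ := hV.at_zero
  have : FiniteDimensional ℂ V := Module.Finite.of_basis c
  obtain ⟨y, hy⟩ := LinearMap.surjective h0 1
  have hfin : finrank ℂ (LinearMap.ker φ) = r := by
    have h1 := φ.finrank_range_add_finrank_ker
    rw [LinearMap.range_eq_top.mpr (LinearMap.surjective h0), finrank_top, finrank_self,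
      finrank_eq_card_basis c, Fintype.card_fin] at h1
    omega
  let N : Submodule ℂ V := LinearMap.ker φ
  have : Module.Free ℂ N := Module.Free.of_divisionRing ℂ N
  let bN : Basis (Fin r) ℂ N := finBasisOfFinrankEq ℂ N hfin
  let b : Basis (Fin (r + 1)) ℂ V := Basis.mkFinCons y bN
    (fun a x hx h => by
      have := congrArg φ h
      rwa [map_add, map_smul, hy, LinearMap.mem_ker.mp hx, map_zero, add_zero, smul_eq_mul,
        mul_one] at this)
    fun z => ⟨-φ z, by rw [LinearMap.mem_ker, map_add, map_smul, hy]; simp⟩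
  have hb : (b : Fin (r + 1) → V) = Fin.cons y (fun j => (bN j : V)) := Basis.coe_mkFinCons _ _ _ _
  obtain ⟨κ, hκ, hW⟩ := hV.exists_wronskianDet_eq b
  -- Both functionals are $1$ on $y$ and vanish on $\ker\varphi$.
  have hφ : b.det.toMultilinearMap.toLinearMap b 0 = φ := by
    refine b.ext fun j => ?_
    simp only [MultilinearMap.toLinearMap_apply, AlternatingMap.coe_multilinearMap]
    cases j using Fin.cases with
    | zero =>
      rw [Function.update_eq_self, Basis.det_self, hb, Fin.cons_zero, hy]
    | succ j =>
      rw [AlternatingMap.map_update_self _ _ (Fin.succ_ne_zero j).symm, hb, Fin.cons_succ]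
      exact (LinearMap.mem_ker.mp (bN j).2).symm
  refine ⟨Function.update (fun j => b j.succ) ⟨0, hr⟩ (κ⁻¹ • b (Fin.succ ⟨0, hr⟩)), fun f => ?_⟩
  have h2 : (Fin.cons f fun j => b j.succ : Fin (r + 1) → V) = Function.update b 0 f := by
    ext1 j
    cases j using Fin.cases with
    | zero => simp
    | succ j => simp
  rw [wronskianDet_cons_eq b, hW, ← mul_assoc, ← C_mul, Fin.cons_update,
    AlternatingMap.map_update_smul]
  have h3 : Function.update (Fin.cons f fun j => b j.succ : Fin (r + 1) → V)
      (Fin.succ ⟨0, hr⟩) (b (Fin.succ ⟨0, hr⟩)) = Function.update b 0 f := by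
    rw [← h2, Function.update_eq_iff]
    exact ⟨by rw [Fin.cons_succ], fun _ _ => rfl⟩
  rw [h3]
  have h4 := LinearMap.congr_fun hφ f
  simp only [MultilinearMap.toLinearMap_apply, AlternatingMap.coe_multilinearMap] at h4
  rw [h4, smul_eq_mul, mul_right_comm, inv_mul_cancel₀ hκ, one_mul]

end Duality

/-! ### Hypergeometric operators: two-term recursion, kernels, contiguity -/

section Hypergeometric

open Module Matrix

/-- The Euler operator `x d/dx`. -/
noncomputable def euler : ℂ[X] →ₗ[ℂ] ℂ[X] := LinearMap.mulLeft ℂ X ∘ₗ derivative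

lemma euler_apply (f : ℂ[X]) : euler f = X * derivative f := rfl

lemma coeff_euler (f : ℂ[X]) (n : ℕ) : (euler f).coeff n = n * f.coeff n := by
  simpa [euler_apply] using coeff_X_pow_mul_iterate_derivative f 1 n

lemma coeff_aeval_euler (A f : ℂ[X]) (n : ℕ) :
    (aeval euler A f).coeff n = A.eval (n : ℂ) * f.coeff n := by
  induction A using Polynomial.induction_on' with
  | add p q hp hq => simp only [map_add, LinearMap.add_apply, coeff_add, hp, hq, eval_add, add_mul]
  | monomial k c =>
    have h : ((euler ^ k) f).coeff n = (n : ℂ) ^ k * f.coeff n := by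
      induction k with
      | zero => simp
      | succ k ih => rw [pow_succ', Module.End.mul_apply, coeff_euler, ih]; ring
    rw [aeval_monomial, Module.End.mul_apply, Module.algebraMap_end_apply, coeff_smul, h,
      eval_monomial, smul_eq_mul, mul_assoc]

/-- The generalized hypergeometric operator `∏ (θ - a_i) - x ∏ (θ - d_i)`, `θ = x d/dx`. -/
noncomputable def hypergeometric {n : ℕ} (a d : Fin n → ℕ) : ℂ[X] →ₗ[ℂ] ℂ[X] :=
  aeval euler (∏ i, (X - C (a i : ℂ))) -
    LinearMap.mulLeft ℂ X ∘ₗ aeval euler (∏ i, (X - C (d i : ℂ)))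

lemma hypergeometric_apply {n : ℕ} (a d : Fin n → ℕ) (f : ℂ[X]) :
    hypergeometric a d f = aeval euler (∏ i, (X - C (a i : ℂ))) f -
      X * aeval euler (∏ i, (X - C (d i : ℂ))) f := rfl

lemma coeff_zero_hypergeometric {n : ℕ} (a d : Fin n → ℕ) (f : ℂ[X]) :
    (hypergeometric a d f).coeff 0 = (∏ i, (((0 : ℕ) : ℂ) - a i)) * f.coeff 0 := by
  simp [hypergeometric_apply, coeff_aeval_euler, eval_prod]

lemma coeff_succ_hypergeometric {n : ℕ} (a d : Fin n → ℕ) (f : ℂ[X]) (N : ℕ) :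
    (hypergeometric a d f).coeff (N + 1) =
      (∏ i, (((N + 1 : ℕ) : ℂ) - a i)) * f.coeff (N + 1) - (∏ i, ((N : ℂ) - d i)) * f.coeff N := by
  simp [hypergeometric_apply, coeff_aeval_euler, eval_prod]

/-- The factor $\theta-a_i$ kills the coefficient of $x^{a_i}$, so the order at $0$ goes up by one.
-/
lemma X_pow_succ_dvd_hypergeometric {n : ℕ} (a d : Fin n → ℕ) {f : ℂ[X]} (i : Fin n)
    (h : X ^ a i ∣ f) : X ^ (a i + 1) ∣ hypergeometric a d f := by
  rw [X_pow_dvd_iff] at h ⊢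
  have h0 : (∏ j, ((a i : ℂ) - a j)) = 0 :=
    Finset.prod_eq_zero (Finset.mem_univ i) (sub_self _)
  intro N hN
  cases N with
  | zero =>
    rw [coeff_zero_hypergeometric]
    rcases Nat.eq_zero_or_pos (a i) with h1 | h1
    · rw [h1] at h0
      rw [h0, zero_mul]
    · rw [h 0 h1, mul_zero]
  | succ N =>
    rw [coeff_succ_hypergeometric, h N (by omega), mul_zero, sub_zero]
    rcases (show N + 1 = a i ∨ N + 1 < a i by omega) with h1 | h1
    · rw [h1, h0, zero_mul]
    · rw [h _ h1, mul_zero]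

/-- The factor $x$ could raise the degree, but $\theta-d_i$ kills the coefficient of $x^{d_i}$. -/
lemma natDegree_hypergeometric_le {n : ℕ} (a d : Fin n → ℕ) {f : ℂ[X]} (i : Fin n)
    (h : f.natDegree ≤ d i) : (hypergeometric a d f).natDegree ≤ d i := by
  rw [natDegree_le_iff_coeff_eq_zero] at h ⊢
  intro N hN
  cases N with
  | zero => omega
  | succ N =>
    rw [coeff_succ_hypergeometric, h _ hN, mul_zero, zero_sub, neg_eq_zero]
    rcases (show N = d i ∨ d i < N by omega) with h1 | h1
    · rw [h1, Finset.prod_eq_zero (Finset.mem_univ i) (sub_self _), zero_mul]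
    · rw [h _ h1, mul_zero]

lemma pow_dvd_euler_pow {f : ℂ[X]} {K : ℕ} (h : (X - C 1) ^ K ∣ f) (s : ℕ) :
    (X - C 1) ^ (K - s) ∣ (euler ^ s) f := by
  induction s with
  | zero => simpa using h
  | succ s ih =>
    rw [pow_succ', Module.End.mul_apply, euler_apply]
    exact (pow_sub_one_dvd_derivative_of_pow_dvd ih).mul_left _

lemma pow_dvd_aeval_euler {f : ℂ[X]} {k m : ℕ} (h : (X - C 1) ^ (k + m) ∣ f) {A : ℂ[X]}
    (hA : A.natDegree ≤ m) : (X - C 1) ^ k ∣ aeval euler A f := by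
  rw [aeval_eq_sum_range, LinearMap.sum_apply]
  refine Finset.dvd_sum fun i hi => ?_
  rw [LinearMap.smul_apply, smul_eq_C_mul]
  refine Dvd.dvd.mul_left ((pow_dvd_pow _ ?_).trans (pow_dvd_euler_pow h i)) _
  have := Finset.mem_range.mp hi
  omega

lemma natDegree_prod_X_sub_C_sub {r : ℕ} (a : Fin (r + 1) → ℂ) :
    (∏ i, (X - C (a i)) - X ^ (r + 1)).natDegree ≤ r := by
  have hm : (∏ i, (X - C (a i))).Monic := monic_prod_of_monic _ _ fun i _ => monic_X_sub_C _
  have hd : (∏ i, (X - C (a i))).natDegree = r + 1 := by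
    rw [natDegree_prod_of_monic _ _ fun i _ => monic_X_sub_C _]; simp
  rw [natDegree_le_iff_coeff_eq_zero]
  intro N hN
  rw [coeff_sub, coeff_X_pow]
  split_ifs with h
  · have h1 := hm.coeff_natDegree
    rw [hd] at h1
    rw [h, h1, sub_self]
  · rw [coeff_eq_zero_of_natDegree_lt (by omega), sub_zero]

/-- The leading part of the operator is $(1-x)\theta^{r+1}$: its factor $1-x$ restores the one order
by which $r+1$ derivatives overshoot. The remaining terms have order at most $r$ in $\theta$. -/
lemma pow_dvd_hypergeometric {r : ℕ} (a d : Fin (r + 1) → ℕ) {f : ℂ[X]} {k : ℕ}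
    (h : (X - C 1) ^ (k + r) ∣ f) : (X - C 1) ^ k ∣ hypergeometric a d f := by
  have hsplit (a : Fin (r + 1) → ℂ) : aeval euler (∏ i, (X - C (a i))) f =
      (euler ^ (r + 1)) f + aeval euler (∏ i, (X - C (a i)) - X ^ (r + 1)) f := by
    simp
  rw [hypergeometric_apply, hsplit, hsplit]
  have h1 : (X - C 1) ^ k ∣ (X - C 1) * (euler ^ (r + 1)) f := by
    refine (pow_dvd_pow _ (show k ≤ k + r - (r + 1) + 1 by omega)).trans ?_
    rw [pow_succ']
    exact mul_dvd_mul_left _ (pow_dvd_euler_pow h _)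
  have h2 := pow_dvd_aeval_euler h (natDegree_prod_X_sub_C_sub fun i => (a i : ℂ))
  have h3 := (pow_dvd_aeval_euler h (natDegree_prod_X_sub_C_sub fun i => (d i : ℂ))).mul_left X
  convert (h2.sub h3).sub h1 using 1
  rw [C_1]
  ring

/-- Replace one row of the Wronskian matrix by the values of the operator. The gain of one order at
$0$ makes the forced zeros outnumber the degree bound, so all these determinants vanish, and
Cramer's rule with a nonzero Wronskian makes the operator vanish on $V$. -/
lemma le_ker_hypergeometric {r : ℕ} {V : Submodule ℂ ℂ[X]} (a d : Fin (r + 1) → ℕ) (k : ℕ)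
    (b0 b1 b2 : Basis (Fin (r + 1)) ℂ V) (h0 : ∀ i, X ^ a i ∣ (b0 i : ℂ[X]))
    (j1 : Fin (r + 1)) (h1 : (X - C 1) ^ (k + r) ∣ (b1 j1 : ℂ[X]))
    (h2 : ∀ i, (b2 i : ℂ[X]).natDegree ≤ d i) (hsum : ∑ i, d i = ∑ i, a i + k)
    (hW : wronskianDet (fun j => (b0 j : ℂ[X])) ≠ 0) :
    V ≤ LinearMap.ker (hypergeometric a d) := by
  have key (j : Fin (r + 1)) : ((wronskianMatrix fun i => (b0 i : ℂ[X])).updateRow j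
      fun i => hypergeometric a d (b0 i)).det = 0 := by
    by_contra hne
    set L : Fin (r + 1) → ℂ[X] →ₗ[ℂ] ℂ[X] :=
      Function.update (fun s => derivative ^ (s : ℕ)) j (hypergeometric a d) with hL
    have hLj (f : ℂ[X]) : L j f = hypergeometric a d f := by rw [hL, Function.update_self]
    have hLs {s : Fin (r + 1)} (hs : s ≠ j) (f : ℂ[X]) : L s f = derivative^[(s : ℕ)] f := by
      rw [hL, Function.update_of_ne hs, Module.End.pow_apply]
    have hM : (wronskianMatrix fun i => (b0 i : ℂ[X])).updateRow j
        (fun i => hypergeometric a d (b0 i)) = opMatrix L fun i => (b0 i : ℂ[X]) := by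
      ext1 s i
      by_cases hs : s = j
      · subst hs
        rw [updateRow_self]
        exact (hLj _).symm
      · rw [updateRow_ne hs]
        exact (hLs hs _).symm
    rw [hM] at hne
    set Q := (opMatrix L fun i => (b0 i : ℂ[X])).det with hQ
    -- The total weight of the derivative rows; row `j`, which carries the operator, needs no power
    -- of $x$.
    set σ := ∑ s : Fin (r + 1), if s = j then 0 else (s : ℕ) with hσ
    have d0 : X ^ (∑ i, a i + 1) ∣ X ^ σ * Q := by
      have := prod_dvd_det (opMatrix L fun i => (b0 i : ℂ[X])) (fun i => X ^ a i)
        (fun s => if s = j then X else 1) (fun s => X ^ (if s = j then 0 else (s : ℕ)))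
        fun s i => by
          change X ^ a i * (if s = j then X else 1) ∣
            X ^ (if s = j then 0 else (s : ℕ)) * L s (b0 i)
          split_ifs with hs
          · subst hs
            rw [hLj, ← pow_succ, pow_zero, one_mul]
            exact X_pow_succ_dvd_hypergeometric a d i (h0 i)
          · rw [hLs hs, mul_one]
            exact pow_dvd_pow_mul_iterate_derivative _ (h0 i)
      rw [Finset.prod_pow_eq_pow_sum, Finset.prod_pow_eq_pow_sum, Finset.prod_ite_eq',
        if_pos (Finset.mem_univ _), ← pow_succ] at this
      exact this
    have d1 : (X - C 1) ^ k ∣ X ^ σ * Q := by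
      have := prod_dvd_det (opMatrix L fun i => (b1 i : ℂ[X]))
        (fun i => if i = j1 then (X - C 1) ^ k else 1) 1 1 fun s i => by
          simp only [Pi.one_apply, mul_one, one_mul]
          change _ ∣ L s (b1 i)
          split_ifs with hi
          · subst hi
            by_cases hs : s = j
            · subst hs
              rw [hLj]
              exact pow_dvd_hypergeometric a d h1
            · rw [hLs hs]
              exact (pow_dvd_pow _ (by omega)).trans
                (pow_sub_dvd_iterate_derivative_of_pow_dvd _ h1)
          · exact one_dvd _
      rw [Finset.prod_ite_eq', if_pos (Finset.mem_univ _)] at this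
      simp only [Pi.one_apply, Finset.prod_const_one, mul_one, one_mul] at this
      rw [hQ, det_opMatrix_eq L b1]
      exact (this.mul_left _).mul_left _
    have d2 : (X ^ σ * Q).natDegree ≤ ∑ i, d i := by
      have := natDegree_det_le (opMatrix L fun i => (b2 i : ℂ[X])) d
        (fun s => if s = j then 0 else (s : ℕ)) fun s i => by
          change (_ * L s (b2 i)).natDegree ≤ _
          split_ifs with hs
          · subst hs
            rw [hLj, pow_zero, one_mul]
            exact natDegree_hypergeometric_le a d i (h2 i)
          · rw [hLs hs]
            exact (natDegree_X_pow_mul_iterate_derivative_le _ _).trans (h2 i)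
      rw [hQ, det_opMatrix_eq L b2, mul_left_comm, natDegree_C_mul (basis_det_ne_zero _ _)]
      exact this
    -- The count is contradictory: $\sum a_i+1+k\le\sum d_i=\sum a_i+k$.
    have h3 := natDegree_le_of_dvd (mul_dvd_of_pow_dvd d0 d1)
      (mul_ne_zero (pow_ne_zero _ X_ne_zero) hne)
    rw [(monic_X_pow _).natDegree_mul ((monic_X_sub_C _).pow _), natDegree_X_pow,
      (monic_X_sub_C _).natDegree_pow, natDegree_X_sub_C, mul_one] at h3
    omega
  have h4 : cramer (wronskianMatrix fun i => (b0 i : ℂ[X]))ᵀ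
      (fun i => hypergeometric a d (b0 i)) = 0 := by
    ext1 j
    rw [cramer_transpose_apply, key j]
    rfl
  have h5 := mulVec_cramer (wronskianMatrix fun i => (b0 i : ℂ[X]))ᵀ
    (fun i => hypergeometric a d (b0 i))
  rw [h4, mulVec_zero, det_transpose, det_wronskianMatrix] at h5
  have h6 (i : Fin (r + 1)) : hypergeometric a d (b0 i) = 0 := by
    have := congrFun h5 i
    simpa [hW] using this
  intro f hf
  rw [LinearMap.mem_ker]
  have h7 : hypergeometric a d ∘ₗ V.subtype = 0 := b0.ext fun i => by simpa using h6 i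
  exact LinearMap.congr_fun h7 ⟨f, hf⟩

/-- By the recursion, a kernel element is determined by its coefficients at the $a_i$, the only
places where the factor $\prod_i(N-a_i)$ vanishes; so the kernel has dimension at most $n$. -/
lemma eq_ker_hypergeometric {n : ℕ} {V : Submodule ℂ ℂ[X]} (a d : Fin n → ℕ)
    (hV : finrank ℂ V = n) (h : V ≤ LinearMap.ker (hypergeometric a d)) :
    V = LinearMap.ker (hypergeometric a d) := by
  let c : LinearMap.ker (hypergeometric a d) →ₗ[ℂ] (Fin n → ℂ) :=
    LinearMap.pi fun i => lcoeff ℂ (a i) ∘ₗ Submodule.subtype _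
  have hc : Function.Injective c := by
    rw [← LinearMap.ker_eq_bot, LinearMap.ker_eq_bot']
    rintro ⟨f, hf⟩ hfc
    have hfa (i : Fin n) : f.coeff (a i) = 0 := congrFun hfc i
    rw [LinearMap.mem_ker] at hf
    have hroot (N : ℕ) (h : (∏ i, ((N : ℂ) - a i)) * f.coeff N = 0) : f.coeff N = 0 := by
      rcases mul_eq_zero.mp h with h | h
      · obtain ⟨i, -, hi⟩ := Finset.prod_eq_zero_iff.mp h
        rw [Nat.cast_injective (sub_eq_zero.mp hi)]
        exact hfa i
      · exact h
    rw [Submodule.mk_eq_zero]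
    ext N
    rw [coeff_zero]
    induction N with
    | zero =>
      refine hroot 0 ?_
      rw [← coeff_zero_hypergeometric a d f, hf, coeff_zero]
    | succ N ih =>
      refine hroot (N + 1) ?_
      have := coeff_succ_hypergeometric a d f N
      rw [hf, coeff_zero, ih, mul_zero, sub_zero] at this
      exact this.symm
  have : FiniteDimensional ℂ (LinearMap.ker (hypergeometric a d)) :=
    Module.Finite.of_injective c hc
  refine Submodule.eq_of_le_of_finrank_le h ?_
  rw [hV]
  simpa using LinearMap.finrank_le_finrank_of_injective hc

/-- A contiguity relation for the hypergeometric operator. -/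
lemma euler_sub_mem_ker_hypergeometric {n : ℕ} (a d d' : Fin n → ℕ) (i : Fin n)
    (hi : d' i = d i + 1) (hj : ∀ j ≠ i, d' j = d j) {g : ℂ[X]}
    (hg : g ∈ LinearMap.ker (hypergeometric a d')) :
    euler g - (d' i : ℂ) • g ∈ LinearMap.ker (hypergeometric a d) := by
  rw [LinearMap.mem_ker] at hg ⊢
  have hco (N : ℕ) : (euler g - (d' i : ℂ) • g).coeff N = ((N : ℂ) - d' i) * g.coeff N := by
    rw [coeff_sub, coeff_euler, coeff_smul, smul_eq_mul, sub_mul]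
  ext N
  rw [coeff_zero]
  cases N with
  | zero =>
    have := coeff_zero_hypergeometric a d' g
    rw [hg, coeff_zero] at this
    rw [coeff_zero_hypergeometric, hco, mul_left_comm, ← this, mul_zero]
  | succ N =>
    have h1 := coeff_succ_hypergeometric a d' g N
    rw [hg, coeff_zero] at h1
    -- Since $N+1-d'_i=N-d_i$, the new recursion at $N$ is $N-d_i$ times the old one; only the
    -- $i$-th factors have to be isolated.
    have h2 : ∏ j ∈ Finset.univ.erase i, ((N : ℂ) - d' j) =
        ∏ j ∈ Finset.univ.erase i, ((N : ℂ) - d j) :=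
      Finset.prod_congr rfl fun j hj' => by rw [hj j (Finset.ne_of_mem_erase hj')]
    rw [← Finset.mul_prod_erase Finset.univ (fun j => ((N : ℂ) - d' j)) (Finset.mem_univ i),
      h2, hi] at h1
    rw [coeff_succ_hypergeometric, hco, hco,
      ← Finset.mul_prod_erase Finset.univ (fun j => ((N : ℂ) - d j)) (Finset.mem_univ i), hi]
    push_cast at h1 ⊢
    linear_combination (-((N : ℂ) - d i)) * h1

end Hypergeometric

/-! ### Combinatorics of the exponents; U and the image of G as one kernel -/

section Parameters

open Module

variable {r : ℕ} {m l : Fin r → ℕ} {k : ℕ}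

/-- The sequence `(k, 0, …, 0)`. -/
def pointOne (r k : ℕ) : Fin r → ℕ := fun s => if (s : ℕ) = 0 then k else 0

lemma sum_pointOne_mul (hr : 0 < r) (c : Fin r → ℕ) :
    ∑ s, pointOne r k s * c s = k * c ⟨0, hr⟩ := by
  rw [Finset.sum_eq_single ⟨0, hr⟩]
  · simp [pointOne]
  · intro s _ hs
    have : (s : ℕ) ≠ 0 := fun h => hs (Fin.ext h)
    simp [pointOne, this]
  · simp

lemma sum_pointOne (hr : 0 < r) : ∑ s, pointOne r k s = k := by
  simpa using sum_pointOne_mul (k := k) hr fun _ => 1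

lemma exponent_pointOne (hr : 0 < r) {i : ℕ} (hi : 0 < i) :
    exponent (pointOne r k) i = i + k := by
  have := sum_pointOne_mul (k := k) hr fun s => if (s : ℕ) < i then 1 else 0
  simp only [mul_ite, mul_one, mul_zero, hi, if_true] at this
  rw [exponent, this]

lemma exponent_zero (n : Fin r → ℕ) : exponent n 0 = 0 := by simp [exponent]

lemma exponent_self (n : Fin r → ℕ) : exponent n r = r + ∑ s, n s := by simp [exponent]

lemma exponent_rev (n : Fin r → ℕ) {i : ℕ} (hi : i ≤ r) :
    exponent (fun s => n s.rev) (r - i) = exponent n r - exponent n i := by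
  have h1 : (∑ s : Fin r, if (s : ℕ) < r - i then n s.rev else 0) =
      ∑ s : Fin r, if (s : ℕ) < i then 0 else n s := by
    rw [← Equiv.sum_comp Fin.revPerm]
    refine Finset.sum_congr rfl fun s _ => ?_
    simp only [Fin.revPerm_apply, Fin.rev_rev, Fin.val_rev]
    have := s.2
    split_ifs <;> first | rfl | omega
  have h2 : (∑ s : Fin r, if (s : ℕ) < i then n s else 0) +
      ∑ s : Fin r, (if (s : ℕ) < i then 0 else n s) = ∑ s, n s := by
    rw [← Finset.sum_add_distrib]
    refine Finset.sum_congr rfl fun s _ => ?_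
    split_ifs <;> simp
  rw [exponent_self]
  unfold exponent
  rw [h1]
  omega

lemma eExp_eq (m l : Fin r → ℕ) (k i : ℕ) :
    eExp m l k i = k - lExt l k i + lExt l k (i + 1) + exponent m i := by
  unfold eExp exponent
  push_cast
  ring

lemma lExt_of_gt (l : Fin r → ℕ) (k : ℕ) : lExt l k (r + 1) = 0 := by simp [lExt]

/-- The difference is $(l_i-l_{i+1})+(m_{i+1}-l_{i+1}+l_{i+2})+1$, and both brackets are
non-negative by consistency. -/
lemma Consistent.eExp_lt (hc : Consistent m l k) {i : ℕ} (hi : i < r) :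
    eExp m l k i < eExp m l k (i + 1) := by
  have h1 := hc.1 i hi
  have h2 := hc.2 ⟨i, hi⟩
  have h3 : exponent m (i + 1) = exponent m i + m ⟨i, hi⟩ + 1 := by
    have : (∑ s : Fin r, if (s : ℕ) < i + 1 then m s else 0) =
        (∑ s : Fin r, if (s : ℕ) < i then m s else 0) + m ⟨i, hi⟩ := by
      have h4 : m ⟨i, hi⟩ = ∑ s : Fin r, if s = ⟨i, hi⟩ then m s else 0 := by simp
      rw [h4, ← Finset.sum_add_distrib]
      refine Finset.sum_congr rfl fun s _ => ?_
      simp only [Fin.ext_iff]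
      split_ifs <;> omega
    unfold exponent
    rw [this]
    ring
  rw [eExp_eq, eExp_eq, h3]
  simp only at h2
  push_cast
  have h5 : i + 1 + 1 = i + 2 := rfl
  rw [h5]
  omega

lemma Consistent.eExp_strictMonoOn (hc : Consistent m l k) {i j : ℕ} (hij : i < j) (hj : j ≤ r) :
    eExp m l k i < eExp m l k j := by
  induction j with
  | zero => omega
  | succ j ih =>
    rcases Nat.lt_succ_iff_lt_or_eq.mp hij with h | h
    · exact (ih h (by omega)).trans (hc.eExp_lt (by omega))
    · subst h; exact hc.eExp_lt (by omega)

lemma Consistent.eExp_mono (hc : Consistent m l k) {i j : ℕ} (hij : i ≤ j) (hj : j ≤ r) :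
    eExp m l k i ≤ eExp m l k j := by
  rcases hij.eq_or_lt with h | h
  · rw [h]
  · exact (hc.eExp_strictMonoOn h hj).le

lemma Consistent.eExp_injOn (hc : Consistent m l k) {i j : ℕ} (hi : i ≤ r) (hj : j ≤ r)
    (h : eExp m l k i = eExp m l k j) : i = j := by
  rcases lt_trichotomy i j with h1 | h1 | h1
  · exact absurd h (hc.eExp_strictMonoOn h1 hj).ne
  · exact h1
  · exact absurd h.symm (hc.eExp_strictMonoOn h1 hi).ne

lemma Consistent.eExp_nonneg (hc : Consistent m l k) {i : ℕ} (hi : i ≤ r) :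
    0 ≤ eExp m l k i := by
  refine le_trans ?_ (hc.eExp_mono (Nat.zero_le i) hi)
  rw [eExp_eq]
  simp only [lExt]
  omega

/-- The exponents `e_i` as natural numbers. -/
def eNat (m l : Fin r → ℕ) (k i : ℕ) : ℕ := (eExp m l k i).toNat

lemma Consistent.eNat_cast (hc : Consistent m l k) {i : ℕ} (hi : i ≤ r) :
    (eNat m l k i : ℤ) = eExp m l k i := Int.toNat_of_nonneg (hc.eExp_nonneg hi)

lemma Consistent.eNat_le (hc : Consistent m l k) {i : ℕ} (hi : i ≤ r) :
    eNat m l k i ≤ r + ∑ s, m s + k := by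
  have h1 := hc.eExp_mono hi le_rfl
  rw [eExp_eq m l k r, exponent_self, lExt_of_gt, ← hc.eNat_cast hi] at h1
  zify
  push_cast at h1 ⊢
  omega

lemma Consistent.eNat_injOn (hc : Consistent m l k) (i : ℕ) (hi : i ≤ r) (j : ℕ) (hj : j ≤ r)
    (h : eNat m l k i = eNat m l k j) : i = j :=
  hc.eExp_injOn hi hj (by rw [← hc.eNat_cast hi, ← hc.eNat_cast hj, h])

/-- The terms $l_{i+1}-l_i$ telescope to $l_{r+1}-l_0=-k$. This is Fuchs' relation for $V$. -/
lemma Consistent.sum_eNat (hc : Consistent m l k) :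
    ∑ i ∈ Finset.range (r + 1), eNat m l k i =
      ∑ i ∈ Finset.range (r + 1), exponent m i + k * r := by
  have h (N : ℕ) : ∑ i ∈ Finset.range N, eExp m l k i =
      N * k - k + lExt l k N + ∑ i ∈ Finset.range N, (exponent m i : ℤ) := by
    induction N with
    | zero => simp [lExt]
    | succ N ih =>
      rw [Finset.sum_range_succ, ih, eExp_eq, Finset.sum_range_succ]
      push_cast
      ring
  zify
  rw [Finset.sum_congr rfl fun i hi =>
    hc.eNat_cast (Nat.lt_succ_iff.mp (Finset.mem_range.mp hi)), h, lExt_of_gt]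
  push_cast
  ring

lemma IsSpaceV.hasFlags (hr : 0 < r) (hc : Consistent m l k) {V : Submodule ℂ ℂ[X]}
    (hV : IsSpaceV m l k V) : HasFlags m (pointOne r k) (eNat m l k) V := by
  refine HasExponents.hasFlags hV (fun i hi => (hc.eNat_cast hi).symm) hc.eNat_injOn ?_
  have h1 := sum_exponent m (r + 1)
  have h2 := sum_pointOne_mul (k := k) hr fun s => r + 1 - ((s : ℕ) + 1)
  simp only [zero_add, Nat.add_sub_cancel] at h2
  have h3 := hc.sum_eNat
  change _ = _ + _ + ∑ s : Fin r, pointOne r k s * _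
  omega

/-- The exponents of `U` at `0`, in decreasing order. -/
def aDual (m : Fin r → ℕ) (i : Fin (r + 1)) : ℕ := exponent m r - exponent m i

/-- The degrees of `U`, in decreasing order. -/
def dDual (m l : Fin r → ℕ) (k : ℕ) (i : Fin (r + 1)) : ℕ := r + ∑ s, m s + k - eNat m l k i

lemma Consistent.sum_dDual (hc : Consistent m l k) :
    ∑ i, dDual m l k i = ∑ i, aDual m i + k := by
  have h1 : ∑ i, dDual m l k i + ∑ i : Fin (r + 1), eNat m l k i =
      (r + 1) * (r + ∑ s, m s + k) := by
    rw [← Finset.sum_add_distrib, Finset.sum_congr rfl fun (i : Fin (r + 1)) _ =>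
      show dDual m l k i + eNat m l k i = r + ∑ s, m s + k from
        Nat.sub_add_cancel (hc.eNat_le (Nat.lt_succ_iff.mp i.2))]
    simp
  have h2 : ∑ i, aDual m i + ∑ i : Fin (r + 1), exponent m i = (r + 1) * (r + ∑ s, m s) := by
    rw [← Finset.sum_add_distrib, ← exponent_self m,
      Finset.sum_congr rfl fun (i : Fin (r + 1)) _ =>
        show aDual m i + exponent m i = exponent m r from
          Nat.sub_add_cancel ((exponent_strictMono m).monotone (Nat.lt_succ_iff.mp i.2))]
    simp
  rw [Fin.sum_univ_eq_sum_range (fun i => eNat m l k i), hc.sum_eNat] at h1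
  rw [Fin.sum_univ_eq_sum_range (fun i => exponent m i)] at h2
  have h3 : (r + 1) * (r + ∑ s, m s + k) = (r + 1) * (r + ∑ s, m s) + (k * r + k) := by ring
  omega

lemma Consistent.dDual_cast (hc : Consistent m l k) (i : Fin (r + 1)) :
    (dDual m l k i : ℤ) = (∑ s : Fin r, if (i : ℕ) ≤ (s : ℕ) then (m s : ℤ) else 0)
      - lExt l k (i + 1) + lExt l k i + r - i := by
  have hi := Nat.lt_succ_iff.mp i.2
  have h1 := hc.eNat_cast hi
  have h2 : (∑ s : Fin r, if (s : ℕ) < i then (m s : ℤ) else 0) +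
      (∑ s : Fin r, if (i : ℕ) ≤ (s : ℕ) then (m s : ℤ) else 0) = ∑ s, (m s : ℤ) := by
    rw [← Finset.sum_add_distrib]
    refine Finset.sum_congr rfl fun s _ => ?_
    split_ifs <;> omega
  rw [dDual, Nat.cast_sub (hc.eNat_le hi), h1, eExp]
  push_cast
  linarith

lemma Consistent.eExpDual_eq (hc : Consistent m l k) (i : Fin (r + 1)) :
    eExpDual m l k (r - i) = dDual m l k i := by
  have hi := Nat.lt_succ_iff.mp i.2
  rw [hc.dDual_cast, eExpDual, Nat.sub_sub_self hi, Nat.cast_sub hi]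
  ring

lemma Consistent.dDual_injective (hc : Consistent m l k) : Function.Injective (dDual m l k) := by
  intro i j h
  have hi := Nat.lt_succ_iff.mp i.2
  have hj := Nat.lt_succ_iff.mp j.2
  have h1 := hc.eNat_le hi
  have h2 := hc.eNat_le hj
  unfold dDual at h
  exact Fin.ext (hc.eNat_injOn _ hi _ hj (by omega))

/-- The sequences `aDual` and `dDual` decrease, to match the functionals dual to a basis of $V$;
hence the reversal of the adapted bases of $U$. -/
lemma IsSpaceU.eq_ker_hypergeometric (hr : 0 < r) (hc : Consistent m l k)
    {U : Submodule ℂ ℂ[X]} (hU : IsSpaceU m l k U) :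
    U = LinearMap.ker (hypergeometric (aDual m) (dDual m l k)) := by
  have hrev (i : ℕ) (hi : i ≤ r) : eExpDual m l k i = dDual m l k (Fin.ofNat (r + 1) (r - i)) := by
    rw [← hc.eExpDual_eq, Fin.val_ofNat, Nat.mod_eq_of_lt (by omega), Nat.sub_sub_self hi]
  obtain ⟨b0, h0⟩ := HasExponents.exists_basis_at_zero hU
  obtain ⟨b1, h1⟩ := exists_basis_of_exponentsAt hU.finrank_eq 1 _ hU.at_one
  obtain ⟨⟨b2, h2⟩, hW⟩ := HasExponents.exists_basis_natDegree hU
    (e := fun i => dDual m l k (Fin.ofNat (r + 1) (r - i))) hrev fun i hi j hj hij => by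
      have := congrArg Fin.val (hc.dDual_injective hij)
      rw [Fin.val_ofNat, Fin.val_ofNat, Nat.mod_eq_of_lt (by omega),
        Nat.mod_eq_of_lt (by omega)] at this
      omega
  refine TwoPointSpaces.eq_ker_hypergeometric _ _ hU.finrank_eq
    (le_ker_hypergeometric _ _ k (b0.reindex Fin.revPerm) b1 (b2.reindex Fin.revPerm)
      (fun i => ?_) (Fin.last r) ?_ (fun i => ?_) hc.sum_dDual (hW _))
  · have := h0 i.rev
    rw [Fin.val_rev, show r + 1 - ((i : ℕ) + 1) = r - i by omega,
      exponent_rev m (Nat.lt_succ_iff.mp i.2)] at this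
    rw [Basis.reindex_apply]
    exact this
  · have := h1 (Fin.last r)
    have h3 : exponent (fun s : Fin r => if (s : ℕ) + 1 = r then k else 0) r = k + r := by
      rw [exponent_self, Finset.sum_eq_single ⟨r - 1, by omega⟩]
      · simp only
        rw [if_pos (by omega), add_comm]
      · intro s _ hs
        exact if_neg fun h => hs (Fin.ext (by simp only; omega))
      · simp
    rwa [Fin.val_last, h3] at this
  · rw [Basis.reindex_apply]
    have := h2 i.rev
    have h4 : Fin.ofNat (r + 1) (r - (i.rev : ℕ)) = i := by
      ext
      rw [Fin.val_ofNat, Fin.val_rev, Nat.mod_eq_of_lt (by omega)]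
      omega
    rw [h4] at this
    exact this.le

lemma IsDualMap.range_eq_ker_hypergeometric (hr : 0 < r) (hc : Consistent m l k)
    {V : Submodule ℂ ℂ[X]} (hV : HasFlags m (pointOne r k) (eNat m l k) V)
    {G : Dual ℂ V →ₗ[ℂ] ℂ[X]} (hG : IsDualMap m (pointOne r k) G) :
    LinearMap.range G = LinearMap.ker (hypergeometric (aDual m) (dDual m l k)) := by
  obtain ⟨b0, h0⟩ := hV.at_zero
  obtain ⟨b1, h1⟩ := hV.at_one
  obtain ⟨b2, h2⟩ := hV.at_infinity
  let c (b : Basis (Fin (r + 1)) ℂ V) : Basis (Fin (r + 1)) ℂ (LinearMap.range G) :=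
    b.dualBasis.map (LinearEquiv.ofInjective G (hG.injective b0))
  have hcb (b : Basis (Fin (r + 1)) ℂ V) (i : Fin (r + 1)) :
      (c b i : ℂ[X]) = G (b.coord i) := by
    simp [c]
  refine eq_ker_hypergeometric _ _ (by simpa using finrank_eq_card_basis (c b0))
    (le_ker_hypergeometric _ _ k (c b0) (c b1) (c b2) (fun i => ?_) 0 ?_ (fun i => ?_)
      hc.sum_dDual ?_)
  · rw [hcb]
    exact hV.X_pow_dvd_dual hG b0 h0 i
  · rw [hcb]
    -- The functional dual to the vector of exponent $0$ at $1$ has an image vanishing there to the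
    -- top order $k+r$.
    have := hV.X_sub_one_pow_dvd_dual hG b1 h1 0
    rwa [Fin.val_zero, exponent_zero, exponent_pointOne hr hr, Nat.sub_zero, add_comm] at this
  · rw [hcb]
    have := hV.natDegree_dual_le hG b2 h2 i
    rwa [sum_pointOne hr] at this
  · simp_rw [hcb]
    exact hG.wronskianDet_ne_zero b0

lemma lExt_addOnes (l : Fin r → ℕ) (k : ℕ) {i : ℕ} (hi : i ≤ r) (j : ℕ) :
    lExt (addOnes l i) (k + 1) j = lExt l k j + if j ≤ i then 1 else 0 := by
  cases j with
  | zero => simp [lExt]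
  | succ j =>
    simp only [lExt, addOnes]
    split_ifs <;> omega

/-- All degrees of $V$ go up by one except the $i$-th. For the dual degrees this means that only the
$i$-th changes. -/
lemma eExp_addOnes (m l : Fin r → ℕ) (k : ℕ) {i : ℕ} (hi : i ≤ r) (j : ℕ) :
    eExp m (addOnes l i) (k + 1) j = eExp m l k j + if j = i then 0 else 1 := by
  rw [eExp_eq, eExp_eq, lExt_addOnes l k hi, lExt_addOnes l k hi]
  push_cast
  split_ifs <;> omega

lemma opDDual_apply_eq (hc : Consistent m l k) (i : Fin (r + 1)) (g : ℂ[X]) :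
    opDDual m l k i g = euler g - (dDual m l k i : ℂ) • g := by
  have h := congrArg (Int.cast : ℤ → ℂ) (hc.dDual_cast i)
  push_cast at h
  rw [h]
  rfl

lemma opDDual_mem_ker_hypergeometric (hc : Consistent m l k) {i : ℕ} (hi : i ≤ r)
    (hc' : Consistent m (addOnes l i) (k + 1)) {g : ℂ[X]}
    (hg : g ∈ LinearMap.ker (hypergeometric (aDual m) (dDual m (addOnes l i) (k + 1)))) :
    opDDual m (addOnes l i) (k + 1) i g ∈
      LinearMap.ker (hypergeometric (aDual m) (dDual m l k)) := by
  have he (j : Fin (r + 1)) : eNat m (addOnes l i) (k + 1) j =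
      eNat m l k j + if (j : ℕ) = i then 0 else 1 := by
    have hj := Nat.lt_succ_iff.mp j.2
    have h1 := hc.eNat_cast hj
    have h2 := hc'.eNat_cast hj
    rw [eExp_addOnes m l k hi, ← h1] at h2
    split_ifs at h2 ⊢ <;> omega
  have hle (j : Fin (r + 1)) := hc.eNat_le (Nat.lt_succ_iff.mp j.2)
  have := euler_sub_mem_ker_hypergeometric (aDual m) (dDual m l k)
    (dDual m (addOnes l i) (k + 1)) ⟨i, Nat.lt_succ_iff.mpr hi⟩ (by
      have h1 := he ⟨i, Nat.lt_succ_iff.mpr hi⟩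
      have h2 := hle ⟨i, Nat.lt_succ_iff.mpr hi⟩
      simp only [if_true] at h1 h2
      simp only [dDual]
      omega) (fun j hj => by
      have h1 := he j
      rw [if_neg fun h => hj (Fin.ext h)] at h1
      have h2 := hle j
      simp only [dDual]
      omega) hg
  rwa [← opDDual_apply_eq hc'] at this

end Parameters

/-! ### The divided Wronskian pairing as evaluation of functionals -/

section Pairing

open Module

variable {r : ℕ} {m l : Fin r → ℕ} {k : ℕ}

lemma prod_tPoly (m : Fin r → ℕ) (k n : ℕ) :
    ∏ j : Fin r, algebraMap ℂ[X] (RatFunc ℂ) (tPoly m k j) ^ (n - ((j : ℕ) + 1)) =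
      algebraMap ℂ[X] (RatFunc ℂ) (tau m (pointOne r k) n) := by
  have h (j : Fin r) : tPoly m k j = X ^ m j * (X - C 1) ^ pointOne r k j := by
    unfold tPoly pointOne
    split_ifs
    · rw [C_1, mul_comm]
    · simp
  simp_rw [← map_pow]
  rw [← map_prod, tau]
  simp_rw [h, mul_pow, ← pow_mul]
  rw [Finset.prod_mul_distrib, Finset.prod_pow_eq_pow_sum, Finset.prod_pow_eq_pow_sum]

lemma dividedWronskian_eq (m : Fin r → ℕ) (k : ℕ) {n : ℕ} (f : Fin n → ℂ[X])
    (p : ℂ[X]) (h : wronskianDet f = tau m (pointOne r k) n * p) :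
    dividedWronskian m k f = algebraMap ℂ[X] (RatFunc ℂ) p := by
  have h0 : algebraMap ℂ[X] (RatFunc ℂ) (tau m (pointOne r k) n) ≠ 0 := by
    rw [Ne, map_eq_zero_iff _ (RatFunc.algebraMap_injective ℂ)]
    exact (tau_monic _ _ _).ne_zero
  rw [dividedWronskian, prod_tPoly, h, map_mul, mul_div_cancel_left₀ _ h0]

/-- The form is $(f,g)\mapsto(E^{-1}g)(f)$; by `IsDualMap.wronskianDet_eq` the functional $E^{-1}g$
is $W^\dagger(\cdot,f_1,\dots,f_r)$ whenever $g=W^\dagger(f_1,\dots,f_r)$. -/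
lemma isDividedWronskianPairing_flip_symm (hr : 0 < r) {e : ℕ → ℕ} {V U : Submodule ℂ ℂ[X]}
    (hV : HasFlags m (pointOne r k) e V) {G : Dual ℂ V →ₗ[ℂ] ℂ[X]}
    (hG : IsDualMap m (pointOne r k) G) (E : Dual ℂ V ≃ₗ[ℂ] U) (hE : ∀ φ, (E φ : ℂ[X]) = G φ) :
    IsDividedWronskianPairing m k (LinearMap.flip (E.symm : U →ₗ[ℂ] V →ₗ[ℂ] ℂ)) := by
  obtain ⟨b, -⟩ := hV.at_zero
  have hdiv (F : Fin r → V) (φ : Dual ℂ V)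
      (h : ∀ f : V, wronskianDet (Fin.cons (f : ℂ[X]) fun j => (F j : ℂ[X])) =
        C (φ f) * tau m (pointOne r k) (r + 1)) :
      dividedWronskian m k (fun j => (F j : ℂ[X])) = algebraMap ℂ[X] (RatFunc ℂ) (E φ) := by
    rw [hE]
    exact dividedWronskian_eq m k _ _ (hG.wronskianDet_eq b F φ h)
  refine ⟨?_, fun f F g hg => ?_⟩
  · ext w
    constructor
    · rintro ⟨g, hgU, rfl⟩
      obtain ⟨F, hF⟩ := hV.exists_family hr (E.symm ⟨g, hgU⟩)
      exact ⟨F, by rw [hdiv F _ hF, LinearEquiv.apply_symm_apply]⟩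
    · rintro ⟨F, rfl⟩
      obtain ⟨φ, hφ⟩ := hV.exists_functional F
      exact ⟨E φ, (E φ).2, hdiv F φ hφ⟩
  · obtain ⟨φ, hφ⟩ := hV.exists_functional F
    rw [hdiv F φ hφ] at hg
    have h1 : g = E φ := Subtype.ext (RatFunc.algebraMap_injective ℂ hg)
    rw [dividedWronskian_eq m k _ (C (φ f)) (by rw [hφ, mul_comm]), h1]
    simp

lemma nondegenerate_flip_symm {V U : Submodule ℂ ℂ[X]} (E : Dual ℂ V ≃ₗ[ℂ] U) :
    (LinearMap.flip (E.symm : U →ₗ[ℂ] V →ₗ[ℂ] ℂ)).Nondegenerate := by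
  refine ⟨fun x hx => ?_, fun y hy => ?_⟩
  · refine (Module.forall_dual_apply_eq_zero_iff ℂ x).mp fun φ => ?_
    simpa using hx (E φ)
  · rw [← LinearEquiv.map_eq_zero_iff E.symm]
    exact LinearMap.ext fun x => hy x

lemma exists_linearEquiv (hr : 0 < r) (hc : Consistent m l k) {V U : Submodule ℂ ℂ[X]}
    (hV : IsSpaceV m l k V) (hU : IsSpaceU m l k U) :
    ∃ (G : Dual ℂ V →ₗ[ℂ] ℂ[X]) (E : Dual ℂ V ≃ₗ[ℂ] U),
      IsDualMap m (pointOne r k) G ∧ ∀ φ, (E φ : ℂ[X]) = G φ := by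
  have hF := hV.hasFlags hr hc
  obtain ⟨G, hG⟩ := hF.exists_isDualMap
  obtain ⟨b, -⟩ := hF.at_zero
  refine ⟨G, (LinearEquiv.ofInjective G (hG.injective b)).trans (LinearEquiv.ofEq _ _
    ((hG.range_eq_ker_hypergeometric hr hc hF).trans (hU.eq_ker_hypergeometric hr hc).symm)),
    hG, fun φ => rfl⟩

end Pairing

/-! ### Maps orthogonal to G and its derivatives are multiplications -/

section Adjoint

open Module Matrix

variable {r : ℕ} {n0 n1 : Fin r → ℕ} {V : Submodule ℂ ℂ[X]} {G : Dual ℂ V →ₗ[ℂ] ℂ[X]}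

/-- By Cramer's rule $W\cdot z$ acts on $V$ as a differential operator $\sum_{s\le r}q_s\,d^s/dx^s$.
Testing against $G^{(t)}$ for $t=0,1,\dots,r-1$ kills $q_r,\dots,q_1$ in turn, by the triangular
relations of `IsDualMap.sum_derivative`. -/
lemma IsDualMap.exists_mul_eq (hG : IsDualMap n0 n1 G) (b : Basis (Fin (r + 1)) ℂ V)
    (z : V →ₗ[ℂ] ℂ[X])
    (hz : ∀ t < r, ∑ i, z (b i) * derivative^[t] (G (b.coord i)) = 0) :
    ∃ Q : ℂ[X], ∀ f : V, wronskianDet (fun j => (b j : ℂ[X])) * z f = Q * f := by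
  set M := wronskianMatrix fun j => (b j : ℂ[X]) with hM
  set q := (fun i => z (b i)) ᵥ* M.adjugate with hq
  have h1 (i : Fin (r + 1)) : M.det * z (b i) = ∑ s, q s * derivative^[(s : ℕ)] (b i : ℂ[X]) := by
    have h2 : q ᵥ* M = M.det • fun i => z (b i) := by
      rw [hq, vecMul_vecMul, adjugate_mul, vecMul_smul, vecMul_one]
    exact (congrFun h2 i).symm
  have h2 (t : ℕ) (ht : t < r) : ∑ s, q s * ∑ i, derivative^[(s : ℕ)] (b i : ℂ[X]) *
      derivative^[t] (G (b.coord i)) = 0 := by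
    rw [← mul_zero M.det, ← hz t ht]
    simp_rw [Finset.mul_sum]
    rw [Finset.sum_comm]
    refine Finset.sum_congr rfl fun i _ => ?_
    rw [← mul_assoc, h1, Finset.sum_mul]
    exact Finset.sum_congr rfl fun s _ => by ring
  have h3 (t : ℕ) (ht : t < r) : q ⟨r - t, by omega⟩ = 0 := by
    induction t using Nat.strong_induction_on with
    | _ t ih =>
      have h4 := h2 t ht
      rw [Finset.sum_eq_single ⟨r - t, by omega⟩, hG.sum_derivative b _ _ (by simp only; omega),
        if_pos (by simp only; omega)] at h4
      · exact (mul_eq_zero.mp h4).resolve_right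
          (mul_ne_zero (pow_ne_zero _ (by simp)) (tProd_ne_zero _ _))
      · intro s _ hs
        -- Terms with $s>r-t$ vanish by induction, those with $s<r-t$ by orthogonality.
        have hs' : (s : ℕ) ≠ r - t := fun h => hs (Fin.ext h)
        rcases Nat.lt_or_ge (r - t) s with h5 | h5
        · have h6 := ih (r - s) (by omega) (by omega)
          rw [show (⟨r - (r - s), by omega⟩ : Fin (r + 1)) = s from
            Fin.ext (by simp only; omega)] at h6
          rw [h6, zero_mul]
        · rw [hG.sum_derivative b _ _ (by omega), if_neg (by omega), mul_zero]
      · simp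
  refine ⟨q 0, fun f => ?_⟩
  have h4 : LinearMap.mulLeft ℂ (wronskianDet fun j => (b j : ℂ[X])) ∘ₗ z =
      LinearMap.mulLeft ℂ (q 0) ∘ₗ V.subtype := by
    refine b.ext fun i => ?_
    simp only [LinearMap.comp_apply, LinearMap.mulLeft_apply, Submodule.subtype_apply]
    rw [← det_wronskianMatrix, ← hM, h1, Finset.sum_eq_single 0]
    · simp
    · intro s _ hs
      have hs' : (s : ℕ) ≠ 0 := fun h => hs (Fin.ext h)
      have h6 := h3 (r - s) (by omega)
      rw [show (⟨r - (r - s), by omega⟩ : Fin (r + 1)) = s from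
        Fin.ext (by simp only; omega)] at h6
      rw [h6, zero_mul]
    · simp
  exact LinearMap.congr_fun h4 f

/-- Without base points $V$ generates the unit ideal, so $W\mid Qf$ for all $f\in V$ gives $W\mid
Q$. -/
lemma exists_eq_mul_of_no_base_point (hV : ∀ z : ℂ, ∃ f ∈ V, f.eval z ≠ 0)
    {W Q : ℂ[X]} (hW : W ≠ 0) (z : V →ₗ[ℂ] ℂ[X]) (h : ∀ f : V, W * z f = Q * f) :
    ∃ q : ℂ[X], ∀ f : V, z f = q * f := by
  have htop : Ideal.span (V : Set ℂ[X]) = ⊤ := by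
    set p := Submodule.IsPrincipal.generator (Ideal.span (V : Set ℂ[X])) with hp
    have hdvd {f : ℂ[X]} (hf : f ∈ V) : p ∣ f :=
      (Submodule.IsPrincipal.mem_iff_generator_dvd _).mp (Ideal.subset_span hf)
    have hnr (x : ℂ) : p.eval x ≠ 0 := fun hx => by
      obtain ⟨f, hf, hfx⟩ := hV x
      exact hfx (eval_eq_zero_of_dvd_of_eval_eq_zero (hdvd hf) hx)
    have hdeg : p.degree = 0 := by
      by_contra hne
      obtain ⟨x, hx⟩ := IsAlgClosed.exists_root p hne
      exact hnr x hx
    exact Ideal.eq_top_of_isUnit_mem _ (Submodule.IsPrincipal.generator_mem _)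
      (isUnit_iff_degree_eq_zero.mpr hdeg)
  have hdvd : ∀ x ∈ Ideal.span (V : Set ℂ[X]), W ∣ Q * x := by
    intro x hx
    induction hx using Submodule.span_induction with
    | mem x hx => exact ⟨z ⟨x, hx⟩, (h ⟨x, hx⟩).symm⟩
    | zero => simp
    | add x y _ _ hx hy => rw [mul_add]; exact dvd_add hx hy
    | smul a x _ hx => rw [smul_eq_mul, mul_left_comm]; exact hx.mul_left a
  obtain ⟨q, hq⟩ := hdvd 1 (htop ▸ Submodule.mem_top)
  rw [mul_one] at hq
  refine ⟨q, fun f => mul_left_cancel₀ hW ?_⟩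
  rw [h, hq, mul_assoc]

end Adjoint

/-! ### Identification of the adjoint with D_i -/

section Operator

open Module

variable {r : ℕ} {m l : Fin r → ℕ} {k i : ℕ}

lemma opD_apply (m l : Fin r → ℕ) (k i : ℕ) (f : ℂ[X]) :
    opD m l k i f = X * (X - 1) * derivative f - C (eExp m l k i : ℂ) * ((X - 1) * f) -
      C ((k : ℂ) + 1) * f := by
  simp only [opD, LinearMap.sub_apply, LinearMap.smul_apply, LinearMap.comp_apply,
    LinearMap.mulLeft_apply, LinearMap.id_apply, smul_eq_C_mul]

lemma coeff_opD_succ (m l : Fin r → ℕ) (k i : ℕ) (f : ℂ[X]) (n : ℕ) :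
    (opD m l k i f).coeff (n + 1) = (n - eExp m l k i : ℂ) * f.coeff n +
      (eExp m l k i - (n + 1) - (k + 1) : ℂ) * f.coeff (n + 1) := by
  have h : opD m l k i f = X * euler f - euler f - C (eExp m l k i : ℂ) * (X * f) +
      C (eExp m l k i : ℂ) * f - C ((k : ℂ) + 1) * f := by
    rw [opD_apply, euler_apply]
    ring
  rw [h]
  simp only [coeff_sub, coeff_add, coeff_C_mul, coeff_X_mul, coeff_euler]
  push_cast
  ring

lemma natDegree_opD_le (m l : Fin r → ℕ) (k i : ℕ) (f : ℂ[X]) :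
    (opD m l k i f).natDegree ≤ f.natDegree + 1 := by
  rw [natDegree_le_iff_coeff_eq_zero]
  intro N hN
  obtain ⟨n, rfl⟩ : ∃ n, N = n + 1 := ⟨N - 1, by omega⟩
  rw [coeff_opD_succ, coeff_eq_zero_of_natDegree_lt (by omega),
    coeff_eq_zero_of_natDegree_lt (by omega), mul_zero, mul_zero, add_zero]

/-- The constant $-(k+1)$ is chosen so that the lowest-order term at $1$ cancels:
$x(k+1)-(k+1)=(k+1)(x-1)$. -/
lemma pow_dvd_opD (m l : Fin r → ℕ) (k i : ℕ) {f : ℂ[X]} (h : (X - C 1) ^ (k + 1) ∣ f) :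
    (X - C 1) ^ (k + 2) ∣ opD m l k i f := by
  obtain ⟨g, rfl⟩ := h
  refine ⟨C ((k : ℂ) + 1) * g + X * derivative g - C (eExp m l k i : ℂ) * g, ?_⟩
  rw [opD_apply, derivative_mul, derivative_X_sub_C_pow]
  simp only [C_1, Nat.add_sub_cancel, C_add, map_natCast]
  push_cast
  ring

lemma IsSpaceV.exists_natDegree_eq (hc : Consistent m l k) {V : Submodule ℂ ℂ[X]}
    (hV : IsSpaceV m l k V) {j : ℕ} (hj : j ≤ r) :
    ∃ f ∈ V, f ≠ 0 ∧ f.natDegree = eNat m l k j := by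
  have : eNat m l k j ∈ exponentsAtInfinity V := by
    rw [hV.at_infinity]
    exact ⟨j, hj, hc.eNat_cast hj⟩
  exact this

lemma IsSpaceV.exists_eNat_eq_natDegree (hc : Consistent m l k) {V : Submodule ℂ ℂ[X]}
    (hV : IsSpaceV m l k V) {f : ℂ[X]} (hf : f ∈ V) (hf0 : f ≠ 0) :
    ∃ j ≤ r, f.natDegree = eNat m l k j := by
  have : f.natDegree ∈ exponentsAtInfinity V := ⟨f, hf, hf0, rfl⟩
  rw [hV.at_infinity] at this
  obtain ⟨j, hj, h⟩ := this
  exact ⟨j, hj, by rw [← hc.eNat_cast hj] at h; exact_mod_cast h⟩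

lemma IsSpaceV.pow_dvd_of_dvd (hr : 0 < r) {V : Submodule ℂ ℂ[X]} (hV : IsSpaceV m l k V)
    {f : ℂ[X]} (hf : f ∈ V) (h : (X - C 1) ∣ f) : (X - C 1) ^ (k + 1) ∣ f := by
  by_cases hf0 : f = 0
  · rw [hf0]; exact dvd_zero _
  have : f.rootMultiplicity 1 ∈ exponentsAt V 1 := ⟨f, hf, hf0, rfl⟩
  rw [hV.at_one] at this
  obtain ⟨j, -, hj⟩ := this
  have h1 : 1 ≤ f.rootMultiplicity 1 := (le_rootMultiplicity_iff hf0).mpr (by rwa [pow_one])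
  change _ = exponent (pointOne r k) j at hj
  rcases Nat.eq_zero_or_pos j with h0 | h0
  · rw [h0, exponent_zero] at hj
    omega
  · rw [exponent_pointOne hr h0] at hj
    exact (le_rootMultiplicity_iff hf0).mp (by omega)

/-- If `f ↦ D_i f - q f` maps `V(l, k)` to `V(l + 1_i, k + 1)` then `q = 0`. -/
lemma eq_zero_of_opD_sub_mul_mem (hr : 0 < r) (hi : i ≤ r) (hc : Consistent m l k)
    (hc' : Consistent m (addOnes l i) (k + 1)) {V V' : Submodule ℂ ℂ[X]}
    (hV : IsSpaceV m l k V) (hV' : IsSpaceV m (addOnes l i) (k + 1) V') {q : ℂ[X]}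
    (h : ∀ f ∈ V, opD m l k i f - q * f ∈ V') : q = 0 := by
  by_contra hq
  have hcast (j : ℕ) (hj : j ≤ r) : eNat m (addOnes l i) (k + 1) j =
      eNat m l k j + if j = i then 0 else 1 := by
    have h1 := hc.eNat_cast hj
    have h2 := hc'.eNat_cast hj
    rw [eExp_addOnes m l k hi, ← h1] at h2
    split_ifs at h2 ⊢ <;> omega
  have hle (j : ℕ) (hj : j ≤ r) : eNat m l k j ≤ eNat m l k r := by
    have h1 := hc.eNat_cast hj
    have h2 := hc.eNat_cast le_rfl
    have h3 := hc.eExp_mono hj le_rfl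
    omega
  -- Test on an element of top degree $e_r$: both $D_if$ and the elements of $V'$ have degree at
  -- most $e_r+1$.
  have hdeg : q.natDegree ≤ 1 := by
    obtain ⟨f, hf, hf0, hfd⟩ := hV.exists_natDegree_eq hc le_rfl
    have h1 : (opD m l k i f - q * f).natDegree ≤ eNat m l k r + 1 := by
      by_cases h0 : opD m l k i f - q * f = 0
      · simp [h0]
      · obtain ⟨j, hj, hjd⟩ := hV'.exists_eNat_eq_natDegree hc' (h f hf) h0
        rw [hjd, hcast j hj]
        have := hle j hj
        split_ifs <;> omega
    have h2 : (q * f).natDegree ≤ eNat m l k r + 1 := by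
      rw [show q * f = opD m l k i f - (opD m l k i f - q * f) by ring]
      refine (natDegree_sub_le _ _).trans (max_le ?_ h1)
      rw [← hfd]
      exact natDegree_opD_le _ _ _ _ _
    rw [natDegree_mul hq hf0, hfd] at h2
    omega
  -- Test on an element of exact order $k+1$ at $1$: elements of $V'$ vanishing at $1$ do so to
  -- order $k+2$, and so does $D_if$, hence $qf$ too.
  have hroot : (X - C 1) ∣ q := by
    have : exponent (pointOne r k) 1 ∈ exponentsAt V 1 := by
      rw [hV.at_one]
      exact ⟨1, hr, rfl⟩
    obtain ⟨f, hf, hf0, hfm⟩ := this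
    rw [exponent_pointOne hr one_pos, add_comm] at hfm
    have h1 : (X - C 1) ^ (k + 1) ∣ f := hfm ▸ pow_rootMultiplicity_dvd f 1
    have h2 := pow_dvd_opD m l k i h1
    have h3 : (X - C 1) ^ (k + 1 + 1) ∣ opD m l k i f - q * f := by
      refine hV'.pow_dvd_of_dvd hr (h f hf) (dvd_sub ?_ ?_)
      · exact (dvd_pow_self _ (by omega)).trans h2
      · exact ((dvd_pow_self _ (by omega)).trans h1).mul_left q
    have h4 : (X - C 1) ^ (k + 2) ∣ q * f := by
      rw [show q * f = opD m l k i f - (opD m l k i f - q * f) by ring]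
      exact dvd_sub h2 h3
    have h5 := (le_rootMultiplicity_iff (mul_ne_zero hq hf0)).mpr h4
    rw [rootMultiplicity_mul (mul_ne_zero hq hf0), hfm] at h5
    have h6 := (le_rootMultiplicity_iff (n := 1) hq).mp (by omega : 1 ≤ q.rootMultiplicity 1)
    rwa [pow_one] at h6
  obtain ⟨c', rfl⟩ := hroot
  have hc0 : c' ≠ 0 := right_ne_zero_of_mul hq
  rw [(monic_X_sub_C (1 : ℂ)).natDegree_mul' hc0, natDegree_X_sub_C] at hdeg
  obtain ⟨c, rfl⟩ := natDegree_eq_zero.mp (show c'.natDegree = 0 by omega)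
  -- Now $q=c(x-1)$. On an element of degree $e_i$ the operator $D_i$ does not raise the degree, so
  -- $D_if-qf$ would have degree $e_i+1$, which is not among the degrees of $V'$.
  obtain ⟨f, hf, hf0, hfd⟩ := hV.exists_natDegree_eq hc hi
  have hcoeff : (opD m l k i f - (X - C 1) * C c * f).coeff (eNat m l k i + 1) =
      -(c * f.leadingCoeff) := by
    have h1 : (eExp m l k i : ℂ) = eNat m l k i := by rw [← hc.eNat_cast hi]; simp
    rw [show (X - C 1) * C c * f = C c * (X * f) - C c * f by rw [C_1]; ring,
      coeff_sub, coeff_opD_succ, h1, coeff_sub, coeff_C_mul, coeff_C_mul, coeff_X_mul,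
      f.coeff_eq_zero_of_natDegree_lt (show f.natDegree < eNat m l k i + 1 by omega),
      leadingCoeff, hfd]
    ring
  have hne : (opD m l k i f - (X - C 1) * C c * f).coeff (eNat m l k i + 1) ≠ 0 := by
    rw [hcoeff]
    exact neg_ne_zero.mpr (mul_ne_zero (C_ne_zero.mp hc0) (leadingCoeff_ne_zero.mpr hf0))
  have hnat : (opD m l k i f - (X - C 1) * C c * f).natDegree = eNat m l k i + 1 := by
    refine le_antisymm ?_ (le_natDegree_of_ne_zero hne)
    refine (natDegree_sub_le _ _).trans (max_le ?_ ?_)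
    · rw [← hfd]
      exact natDegree_opD_le _ _ _ _ _
    · rw [mul_assoc, (monic_X_sub_C (1 : ℂ)).natDegree_mul' (mul_ne_zero hc0 hf0),
        natDegree_C_mul (C_ne_zero.mp hc0), natDegree_X_sub_C, hfd, add_comm]
  obtain ⟨j, hj, hjd⟩ := hV'.exists_eNat_eq_natDegree hc' (h f hf)
    fun h0 => hne (by rw [h0, coeff_zero])
  rw [hnat, hcast j hj] at hjd
  split_ifs at hjd with hji
  · subst hji; omega
  · exact hji (hc.eNat_injOn j hj i hi (by omega))

lemma tProd_pointOne_succ (hr : 0 < r) (m : Fin r → ℕ) (k : ℕ) :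
    tProd m (pointOne r (k + 1)) = (X - 1) * tProd m (pointOne r k) := by
  rw [tProd, tProd, sum_pointOne hr, sum_pointOne hr, pow_succ, C_1]
  ring

/-- The adjoint of `-D_i^∨` is `D_i`. -/
lemma adjoint_eq_opD (hr : 0 < r) (hi : i ≤ r) (hc : Consistent m l k)
    (hc' : Consistent m (addOnes l i) (k + 1)) {V V' : Submodule ℂ ℂ[X]}
    (hV : IsSpaceV m l k V) (hV' : IsSpaceV m (addOnes l i) (k + 1) V')
    {G : Dual ℂ V →ₗ[ℂ] ℂ[X]} {G' : Dual ℂ V' →ₗ[ℂ] ℂ[X]}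
    (hG : IsDualMap m (pointOne r k) G) (hG' : IsDualMap m (pointOne r (k + 1)) G')
    (b' : Basis (Fin (r + 1)) ℂ V') (E : Dual ℂ V' →ₗ[ℂ] Dual ℂ V)
    (hE : ∀ ψ, G (E ψ) = opDDual m (addOnes l i) (k + 1) i (G' ψ)) (D : V →ₗ[ℂ] V')
    (hD : ∀ f, D f = -∑ j, E (b'.coord j) f • b' j) (f : V) :
    (D f : ℂ[X]) = opD m l k i f := by
  have hF := hV.hasFlags hr hc
  obtain ⟨b, -⟩ := hF.at_zero
  obtain ⟨c, hcd⟩ : ∃ c : ℂ, c = dDual m (addOnes l i) (k + 1) ⟨i, Nat.lt_succ_iff.mpr hi⟩ :=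
    ⟨_, rfl⟩
  have hop (g : ℂ[X]) (t : ℕ) :
      derivative^[t] (opDDual m (addOnes l i) (k + 1) i g) =
        X * derivative^[t + 1] g + (C (t : ℂ) - C c) * derivative^[t] g := by
    have h1 := opDDual_apply_eq hc' ⟨i, Nat.lt_succ_iff.mpr hi⟩ g
    rw [← hcd] at h1
    rw [h1, euler_apply, iterate_derivative_sub, mul_comm, iterate_derivative_mul_X,
      iterate_derivative_smul, smul_eq_C_mul, ← Function.iterate_succ_apply]
    cases t with
    | zero => simp; ring
    | succ t =>
      rw [Nat.add_sub_cancel, ← Function.iterate_succ_apply, nsmul_eq_mul]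
      simp only [map_natCast, Nat.succ_eq_add_one]
      ring
  let z : V →ₗ[ℂ] ℂ[X] := opD m l k i ∘ₗ V.subtype - V'.subtype ∘ₗ D
  have hzapp (f : V) : z f = opD m l k i f - D f := rfl
  -- Only the derivative terms of $D_i$ and $D_i^\vee$ contribute, and only for $t=r-1$. They agree
  -- because $T_1\cdots T_r$ for $k+1$ is $x-1$ times that for $k$, and the opposite signs of the
  -- two relations absorb the minus in the definition of $D$.
  have hz (t : ℕ) (ht : t < r) : ∑ i, z (b i) * derivative^[t] (G (b.coord i)) = 0 := by
    have hS0 := hG.sum_derivative b 0 t (by omega)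
    have hS1 := hG.sum_derivative b 1 t (by omega)
    have hS0' := hG'.sum_derivative b' 0 t (by omega)
    have hS1' := hG'.sum_derivative b' 0 (t + 1) (by omega)
    rw [if_neg (by omega)] at hS0 hS0'
    simp only [Function.iterate_zero, Function.iterate_one, id] at hS0 hS1 hS0' hS1'
    have h1 : ∑ j, opD m l k i (b j) * derivative^[t] (G (b.coord j)) =
        X * (X - 1) * ∑ j, derivative (b j : ℂ[X]) * derivative^[t] (G (b.coord j)) -
          (C (eExp m l k i : ℂ) * (X - 1) + C ((k : ℂ) + 1)) *
            ∑ j, (b j : ℂ[X]) * derivative^[t] (G (b.coord j)) := by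
      rw [Finset.mul_sum, Finset.mul_sum, ← Finset.sum_sub_distrib]
      refine Finset.sum_congr rfl fun j _ => ?_
      rw [opD_apply]
      ring
    have h2 : ∑ j, (D (b j) : ℂ[X]) * derivative^[t] (G (b.coord j)) =
        -∑ j, (b' j : ℂ[X]) *
          derivative^[t] (opDDual m (addOnes l i) (k + 1) i (G' (b'.coord j))) := by
      have h3 (j : Fin (r + 1)) :
          derivative^[t] (opDDual m (addOnes l i) (k + 1) i (G' (b'.coord j))) =
            ∑ s, C (E (b'.coord j) (b s)) * derivative^[t] (G (b.coord s)) := by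
        rw [← hE]
        conv_lhs => rw [← b.sum_dual_apply_smul_coord (E (b'.coord j))]
        rw [map_sum, iterate_derivative_sum]
        refine Finset.sum_congr rfl fun s _ => ?_
        rw [map_smul, iterate_derivative_smul, smul_eq_C_mul]
      simp_rw [h3, hD, Submodule.coe_neg, Submodule.coe_sum, Submodule.coe_smul, smul_eq_C_mul,
        neg_mul, Finset.sum_mul, Finset.mul_sum, Finset.sum_neg_distrib]
      rw [Finset.sum_comm]
      refine congrArg _ (Finset.sum_congr rfl fun j _ => Finset.sum_congr rfl fun s _ => by ring)
    have h4 : ∑ j, (b' j : ℂ[X]) *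
          derivative^[t] (opDDual m (addOnes l i) (k + 1) i (G' (b'.coord j))) =
        X * ∑ j, (b' j : ℂ[X]) * derivative^[t + 1] (G' (b'.coord j)) +
          (C (t : ℂ) - C c) * ∑ j, (b' j : ℂ[X]) * derivative^[t] (G' (b'.coord j)) := by
      rw [Finset.mul_sum, Finset.mul_sum, ← Finset.sum_add_distrib]
      refine Finset.sum_congr rfl fun j _ => ?_
      rw [hop]
      ring
    simp_rw [hzapp, sub_mul, Finset.sum_sub_distrib]
    rw [h1, h2, h4, hS0, hS1, hS0', hS1', tProd_pointOne_succ hr, zero_add, add_comm 1 t]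
    split_ifs
    · ring
    · ring
  obtain ⟨Q, hQ⟩ := hG.exists_mul_eq b z hz
  obtain ⟨q, hq⟩ := exists_eq_mul_of_no_base_point hV.no_base_point (hF.wronskian b) z hQ
  have hq0 : q = 0 := by
    refine eq_zero_of_opD_sub_mul_mem hr hi hc hc' hV hV' fun f hf => ?_
    have h5 := hq ⟨f, hf⟩
    rw [hzapp] at h5
    rw [← h5, sub_sub_cancel]
    exact (D ⟨f, hf⟩).2
  have h6 := hq f
  rw [hzapp, hq0, zero_mul] at h6
  exact (sub_eq_zero.mp h6).symm

end Operator

end TwoPointSpaces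

theorem mainTheorem10 {r : ℕ} (hr : 0 < r) (m l : Fin r → ℕ) (k i : ℕ) (hi : i ≤ r)
    (hc : TwoPointSpaces.Consistent m l k)
    (hc' : TwoPointSpaces.Consistent m (TwoPointSpaces.addOnes l i) (k + 1))
    (V U V' U' : Submodule ℂ (Polynomial ℂ))
    (hV : TwoPointSpaces.IsSpaceV m l k V)
    (hU : TwoPointSpaces.IsSpaceU m l k U)
    (hV' : TwoPointSpaces.IsSpaceV m (TwoPointSpaces.addOnes l i) (k + 1) V')
    (hU' : TwoPointSpaces.IsSpaceU m (TwoPointSpaces.addOnes l i) (k + 1) U') :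
    ∃ (B : V →ₗ[ℂ] U →ₗ[ℂ] ℂ) (B' : V' →ₗ[ℂ] U' →ₗ[ℂ] ℂ)
      (D : V →ₗ[ℂ] V') (Dd : U' →ₗ[ℂ] U),
      TwoPointSpaces.IsDividedWronskianPairing m k B ∧ B.Nondegenerate ∧
      TwoPointSpaces.IsDividedWronskianPairing m (k + 1) B' ∧ B'.Nondegenerate ∧
      (∀ f : V, (D f : Polynomial ℂ) = TwoPointSpaces.opD m l k i f) ∧
      (∀ g : U', (Dd g : Polynomial ℂ) =
        TwoPointSpaces.opDDual m (TwoPointSpaces.addOnes l i) (k + 1) i g) ∧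
      ∀ (f : V) (g : U'), B' (D f) g = -B f (Dd g) := by
  obtain ⟨G, E, hG, hE⟩ := TwoPointSpaces.exists_linearEquiv hr hc hV hU
  obtain ⟨G', E', hG', hE'⟩ := TwoPointSpaces.exists_linearEquiv hr hc' hV' hU'
  have hF := TwoPointSpaces.IsSpaceV.hasFlags hr hc hV
  have hF' := TwoPointSpaces.IsSpaceV.hasFlags hr hc' hV'
  obtain ⟨b', -⟩ := hF'.at_zero
  have hmap : ∀ g ∈ U',
      TwoPointSpaces.opDDual m (TwoPointSpaces.addOnes l i) (k + 1) i g ∈ U := by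
    intro g hg
    rw [TwoPointSpaces.IsSpaceU.eq_ker_hypergeometric hr hc' hU'] at hg
    rw [TwoPointSpaces.IsSpaceU.eq_ker_hypergeometric hr hc hU]
    exact TwoPointSpaces.opDDual_mem_ker_hypergeometric hc hi hc' hg
  let Dd : U' →ₗ[ℂ] U :=
    (TwoPointSpaces.opDDual m (TwoPointSpaces.addOnes l i) (k + 1) i).restrict hmap
  let A : Module.Dual ℂ V' →ₗ[ℂ] Module.Dual ℂ V :=
    (E.symm : U →ₗ[ℂ] Module.Dual ℂ V) ∘ₗ Dd ∘ₗ (E' : Module.Dual ℂ V' →ₗ[ℂ] U')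
  have hA (ψ : Module.Dual ℂ V') : E (A ψ) = Dd (E' ψ) := by simp [A]
  -- Minus the transpose of `A`, written in coordinates: $\psi(Df)=-(A\psi)(f)$ for every functional
  -- $\psi$ on $V'$.
  let D : V →ₗ[ℂ] V' := -∑ j, (A (b'.coord j)).smulRight (b' j)
  have hD (f : V) : D f = -∑ j, A (b'.coord j) f • b' j := by
    simp [D, LinearMap.sum_apply]
  refine ⟨_, _, D, Dd, TwoPointSpaces.isDividedWronskianPairing_flip_symm hr hF hG E hE,
    TwoPointSpaces.nondegenerate_flip_symm E,
    TwoPointSpaces.isDividedWronskianPairing_flip_symm hr hF' hG' E' hE',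
    TwoPointSpaces.nondegenerate_flip_symm E',
    TwoPointSpaces.adjoint_eq_opD hr hi hc hc' hV hV' hG hG' b' A (fun ψ => ?_) D hD,
    fun g => rfl, fun f g => ?_⟩
  · rw [← hE, hA, ← hE']
    rfl
  · obtain ⟨ψ, rfl⟩ := E'.surjective g
    have h1 : A ψ f = ∑ j, A (b'.coord j) f * ψ (b' j) := by
      conv_lhs => rw [← b'.sum_dual_apply_smul_coord ψ]
      rw [map_sum, LinearMap.sum_apply]
      exact Finset.sum_congr rfl fun j _ => by
        rw [map_smul, LinearMap.smul_apply, smul_eq_mul, mul_comm]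
    rw [← hA]
    simp only [LinearMap.flip_apply, LinearEquiv.coe_coe, LinearEquiv.symm_apply_apply]
    rw [hD, h1, map_neg, map_sum]
    simp
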